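/- Let $N\ge 1$ be an integer, $\Lambda\ge 1$, $m\ge 0$, $\delta_N>0$. Put $\omega(k)=(|k|^2+m^2)^{1/2}$ and $\tilde\eta(k)=\frac{(2\pi)^{-3/2}}{\sqrt{2\omega(k)}}\mathbf 1_{|k|\le\Lambda}(k)$ for $k\in\mathbb R^3$, let $\mathcal F[f](k)=(2\pi)^{-3/2}\int_{\mathbb R^3}e^{-ik\cdot x}f(x)\,dx$, let $H^2(\mathbb R^3)$ be the Sobolev space of order two, and let $L^2_1(\mathbb R^3)=\{\alpha\in L^2(\mathbb R^3):(1+|\cdot|^2)^{1/2}\alpha\in L^2(\mathbb R^3)\}$ (all functions being complex-valued). The fermionic Schrödinger–Klein–Gordon system with ultraviolet cutoff is $$ \begin{cases} N^{-1/3}\, i\partial_t\varphi_j^t(x)=\big(-N^{-2/3}\Delta+\Phi_\Lambda(x,t)\big)\varphi_j^t(x),\qquad j=1,\dots,N,\\ i\partial_t\alpha^t(k)=N^{-1/3}\delta_N\,\omega(k)\alpha^t(k)+N^{-1}(2\pi)^{3/2}\,\tilde\eta(k)\,\mathcal F[\rho^t](k),\\ \Phi_\Lambda(x,t)=\int_{\mathbb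 R^3}\tilde\eta(k)\big(e^{ik\cdot x}\alpha^t(k)+e^{-ik\cdot x}\overline{\alpha^t(k)}\big)\,dk, \end{cases} \qquad \rho^t=\sum_{j=1}^N|\varphi_j^t|^2 . $$ By a solution we mean a function $t\mapsto(\varphi_1^t,\dots,\varphi_N^t,\alpha^t)$ on $[0,\infty)$ that takes values in $H^2(\mathbb R^3)^N\oplus L^2_1(\mathbb R^3)$, is strongly differentiable, i.e. differentiable in the norm of $L^2(\mathbb R^3)^{N}\oplus L^2(\mathbb R^3)$ (one-sidedly at $t=0$), and satisfies the system, as an identity in $L^2(\mathbb R^3)$ for each component, at every $t\in[0,\infty)$. Let $(\varphi_1^0,\dots,\varphi_N^0,\alpha^0)\in H^2(\mathbb R^3)^N\oplus L^2_1(\mathbb R^3)$. Then there is a solution with this initial value at $t=0$. Moreover, if $\varphi_1^0,\dots,\varphi_N^0$ are orthonormal in $L^2(\mathbb R^3)$, then for every solution with this initial value $\varphi_1^t,\dots,\varphi_N^t$ are orthonormal for all $t\in[0,\infty)$. -/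

import Mathlib

open MeasureTheory
open scoped Laplacian SchwartzMap

noncomputable section

namespace FSKG

/-- Three-dimensional Euclidean space. -/
abbrev R3 : Type := EuclideanSpace ℝ (Fin 3)

/-- The complex Hilbert space `L²(ℝ³)`. -/
abbrev L2 : Type := Lp ℂ 2 (volume : Measure R3)

/-- The space `L²(ℝ³)^N ⊕ L²(ℝ³)` of pairs `((φ₁, …, φ_N), α)`. It carries the maximum of the
component norms, which is equivalent to the Hilbert sum norm (the sum is finite), so that
derivatives with respect to the two norms are the same. -/
abbrev State (N : ℕ) : Type := (Fin N → L2) × L2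

/-- Membership in the Sobolev space `H²(ℝ³)`. -/
def MemH2 (f : L2) : Prop :=
  TemperedDistribution.MemSobolev 2 2 (Lp.toTemperedDistribution f)

/-- Membership in the weighted space `L²₁(ℝ³)`: the function `(1 + |k|²)^{1/2} f(k)` is in `L²`. -/
def MemL21 (f : L2) : Prop :=
  MemLp (fun k : R3 => (((1 + ‖k‖ ^ 2) ^ (1 / 2 : ℝ) : ℝ) : ℂ) * f k) 2 volume

/-- Membership in `H²(ℝ³)^N ⊕ L²₁(ℝ³)`. -/
def InDomain {N : ℕ} (u : State N) : Prop :=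
  (∀ j, MemH2 (u.1 j)) ∧ MemL21 u.2

/-- `g ∈ L²` is the distributional Laplacian of `f ∈ L²`. -/
def IsLaplacian (f g : L2) : Prop :=
  Δ (Lp.toTemperedDistribution f : 𝓢'(R3, ℂ)) = Lp.toTemperedDistribution g

/-- The dispersion relation `ω(k) = (|k|² + m²)^{1/2}`. -/
def omega (m : ℝ) (k : R3) : ℝ := Real.sqrt (‖k‖ ^ 2 + m ^ 2)

open Classical in
/-- The cut-off form factor `(2π)^{-3/2} (2 ω(k))^{-1/2} 1_{|k| ≤ Λ}`. -/
def eta (m Λ : ℝ) (k : R3) : ℝ :=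
  if ‖k‖ ≤ Λ then (2 * Real.pi) ^ (-3 / 2 : ℝ) / Real.sqrt (2 * omega m k) else 0

/-- The plane wave `e^{i k·x}`. -/
def planeWave (k x : R3) : ℂ := Complex.exp (Complex.I * ((inner ℝ k x : ℝ) : ℂ))

/-- The Fourier transform `𝓕[f](k) = (2π)^{-3/2} ∫ e^{-i k·x} f(x) dx`
of a (Lebesgue integrable) real function. -/
def fourierT (f : R3 → ℝ) (k : R3) : ℂ :=
  (((2 * Real.pi) ^ (-3 / 2 : ℝ) : ℝ) : ℂ) * ∫ x : R3, planeWave (-k) x * (f x : ℂ)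

/-- The density `ρ(x) = ∑_j |φ_j(x)|²`. -/
def density {N : ℕ} (φ : Fin N → L2) (x : R3) : ℝ := ∑ j, ‖φ j x‖ ^ 2

/-- The classical radiation field
`Φ_Λ(x) = ∫ η(k) (e^{i k·x} α(k) + e^{-i k·x} conj(α(k))) dk`. -/
def field (m Λ : ℝ) (α : L2) (x : R3) : ℂ :=
  ∫ k : R3, (eta m Λ k : ℂ) *
    (planeWave k x * α k + planeWave (-k) x * (starRingEnd ℂ) (α k))

/-- `N^{-1/3} i v = (-N^{-2/3} Δ + Φ) φ` in `L²(ℝ³)`, where `v` stands for `∂_t φ`. -/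
def SchroedingerEq (N : ℕ) (Φ : R3 → ℂ) (φ v : L2) : Prop :=
  ∃ g : L2, IsLaplacian φ g ∧ ∀ᵐ x : R3,
    (((N : ℝ) ^ (-1 / 3 : ℝ) : ℝ) : ℂ) * Complex.I * v x =
      -(((N : ℝ) ^ (-2 / 3 : ℝ) : ℝ) : ℂ) * g x + Φ x * φ x

/-- `i v = N^{-1/3} δ ω α + N^{-1} (2π)^{3/2} η 𝓕[ρ]` in `L²(ℝ³)`, where `v` stands for `∂_t α`. -/
def KleinGordonEq (N : ℕ) (m Λ δ : ℝ) (ρ : R3 → ℝ) (α v : L2) : Prop :=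
  ∀ᵐ k : R3, Complex.I * v k =
    (((N : ℝ) ^ (-1 / 3 : ℝ) * δ * omega m k : ℝ) : ℂ) * α k +
      (((N : ℝ)⁻¹ * (2 * Real.pi) ^ (3 / 2 : ℝ) * eta m Λ k : ℝ) : ℂ) * fourierT ρ k

/-- `u = ((φ₁, …, φ_N), α)` restricted to `[0, ∞)` takes values in `H²(ℝ³)^N ⊕ L²₁(ℝ³)`, is
strongly differentiable (one-sidedly at `0`), i.e. in the norm of `L²(ℝ³)^N ⊕ L²(ℝ³)`, and
satisfies the fermionic Schrödinger–Klein–Gordon system at each time. -/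
def IsSolution (N : ℕ) (m Λ δ : ℝ) (u : ℝ → State N) : Prop :=
  ∀ t : ℝ, 0 ≤ t → InDomain (u t) ∧
    ∃ v : State N, HasDerivWithinAt u v (Set.Ici 0) t ∧
      (∀ j, SchroedingerEq N (field m Λ (u t).2) ((u t).1 j) (v.1 j)) ∧
      KleinGordonEq N m Λ δ (density (u t).1) (u t).2 v.2

end FSKG

end

/-! The system has the form u' = A u + F(u). Here A generates the free group U(t), which acts by
e^{i t ε Δ} with ε = N^{-1/3} on each particle and by the phase e^{-i t ε δ ω} on the field; it is
isometric. The cutoff makes η square integrable. By Cauchy–Schwarz the field is therefore bounded by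
a multiple of ‖α‖, and the source η 𝓕[ρ] is controlled in L² by the L¹ norm of ρ, so F is Lipschitz
on balls of the plain L² state space.

In the interaction picture w(t) = U(-t) u(t) the unbounded generator disappears and w' = U(-t)
F(U(t) w) is an ordinary differential equation with a locally Lipschitz right-hand side. Since Φ is
real, the norms ‖φ_j‖ are conserved. Hence the source is bounded and ‖α‖ grows at most linearly.
This a priori bound survives a radial truncation of F, so Picard–Lindelöf applies on every [0, T],
and the pieces glue by uniqueness (`IsometryGroup.exists_solution_Icc`,
`norm_le_of_scaled_interaction`, `exists_global_solution`).

To return to a strong solution, u(t) must lie in H² ⊕ L²₁. This domain consists exactly of the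
vectors with Lipschitz orbits under U: one inclusion is differentiation on the Fourier side, the
other is Fatou's lemma applied to difference quotients. Comparing u with its time translates by
Grönwall's inequality shows that Lipschitz orbits propagate
(`IsometryGroup.isLipschitzVector_of_solution`), and the product rule then yields the equation.

Orthonormality needs no uniqueness: along any solution all φ_j evolve under the same symmetric
operator -ε²Δ + Φ, so every entry of the Gram matrix has zero derivative
(`inner_add_inner_eq_zero`). -/

namespace FSKG

section

open Set Filter Topology Metric FourierTransform TemperedDistribution
open scoped NNReal ENNReal ContDiff

/-! ### Isometry groups and their locally Lipschitz perturbations -/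

/-- A strongly continuous one-parameter group of linear isometries. -/
structure IsometryGroup (X : Type*) [NormedAddCommGroup X] [NormedSpace ℝ X] where
  op : ℝ → X →ₗᵢ[ℝ] X
  op_zero : ∀ x, op 0 x = x
  op_add : ∀ s t x, op (s + t) x = op s (op t x)
  tendsto_zero : ∀ x, Tendsto (fun t => op t x) (𝓝 0) (𝓝 x)

section Abstract

variable {X : Type*} [NormedAddCommGroup X] [NormedSpace ℝ X]

namespace IsometryGroup

variable (U : IsometryGroup X)

theorem op_op_neg (t : ℝ) (x : X) : U.op t (U.op (-t) x) = x := by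
  rw [← U.op_add, add_neg_cancel, U.op_zero]

/-- Joint continuity in time and vector: the group law moves the time limit to zero, and isometry
makes the error from `y i - x` uniform in time. -/
theorem tendsto_op_apply {ι : Type*} {l : Filter ι} {τ : ι → ℝ} {y : ι → X} {t : ℝ} {x : X}
    (hτ : Tendsto τ l (𝓝 t)) (hy : Tendsto y l (𝓝 x)) :
    Tendsto (fun i => U.op (τ i) (y i)) l (𝓝 (U.op t x)) := by
  have h1 : Tendsto (fun i => U.op (τ i - t) x) l (𝓝 x) :=
    (U.tendsto_zero x).comp (by simpa using hτ.sub_const t)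
  have h2 : Tendsto (fun i => U.op t (U.op (τ i - t) x)) l (𝓝 (U.op t x)) :=
    ((U.op t).continuous.tendsto x).comp h1
  have h3 : Tendsto (fun i => U.op (τ i) (y i - x)) l (𝓝 0) := by
    rw [tendsto_zero_iff_norm_tendsto_zero]
    simp only [LinearIsometry.norm_map]
    exact tendsto_zero_iff_norm_tendsto_zero.1 (by simpa using hy.sub_const x)
  have h4 := h2.add h3
  rw [add_zero] at h4
  refine h4.congr fun i => ?_
  rw [← U.op_add, add_sub_cancel, map_sub]
  abel

/-- The vector field of the evolution equation in the interaction picture. -/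
def interaction (F : X → X) (t : ℝ) (x : X) : X := U.op (-t) (F (U.op t x))

/-- Isometries preserve centred balls and distances, so the constant of F serves for all times at
once. -/
theorem lipschitzOnWith_interaction {F : X → X} {K : ℝ≥0} {R : ℝ}
    (hF : LipschitzOnWith K F (closedBall 0 R)) (t : ℝ) :
    LipschitzOnWith K (U.interaction F t) (closedBall 0 R) := by
  refine LipschitzOnWith.of_dist_le_mul fun x hx y hy => ?_
  have := hF.dist_le_mul (U.op t x) (by simpa using hx) (U.op t y) (by simpa using hy)
  rwa [(U.op t).dist_map, ← (U.op (-t)).dist_map] at this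

theorem continuous_interaction {F : X → X} (hF : Continuous F) (x : X) :
    Continuous fun t => U.interaction F t x := by
  rw [continuous_iff_continuousAt]
  intro t
  refine U.tendsto_op_apply (continuous_neg.tendsto t) ?_
  exact (hF.tendsto _).comp (U.tendsto_op_apply tendsto_id tendsto_const_nhds)

end IsometryGroup

/-- The factor by which the radial retraction onto the ball of radius `R` scales `x`. -/
noncomputable def radialFactor {X : Type*} [NormedAddCommGroup X] (R : ℝ) (x : X) : ℝ := R / max R ‖x‖

theorem radialFactor_mem {X : Type*} [NormedAddCommGroup X] {R : ℝ} (hR : 0 < R) (x : X) : radialFactor R x ∈ Icc (0 : ℝ) 1 := by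
  have : 0 < max R ‖x‖ := lt_max_of_lt_left hR
  exact ⟨by unfold radialFactor; positivity, (div_le_one this).2 (le_max_left _ _)⟩

theorem radialFactor_of_norm_le {X : Type*} [NormedAddCommGroup X] {R : ℝ} (hR : 0 < R) {x : X}
    (hx : ‖x‖ ≤ R) : radialFactor R x = 1 := by
  rw [radialFactor, max_eq_left hx, div_self hR.ne']

theorem norm_radialFactor_smul_le {R : ℝ} (hR : 0 < R) (x : X) : ‖radialFactor R x • x‖ ≤ R := by
  have : 0 < max R ‖x‖ := lt_max_of_lt_left hR
  rw [norm_smul, Real.norm_of_nonneg (radialFactor_mem hR x).1, radialFactor, div_mul_eq_mul_div,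
    div_le_iff₀ this]
  gcongr
  exact le_max_right _ _

/-- Changing the vector and changing the factor each cost at most ‖x - y‖, which gives the constant
2 in any normed space. -/
theorem lipschitzWith_radialFactor_smul {R : ℝ} (hR : 0 < R) :
    LipschitzWith 2 fun x : X => radialFactor R x • x := by
  refine LipschitzWith.of_dist_le_mul fun x y => ?_
  have hx : 0 < max R ‖x‖ := lt_max_of_lt_left hR
  have hy : 0 < max R ‖y‖ := lt_max_of_lt_left hR
  have h1 : |radialFactor R x - radialFactor R y| * ‖y‖ ≤ ‖x - y‖ := by
    have e : radialFactor R x - radialFactor R y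
        = (max R ‖y‖ - max R ‖x‖) * (radialFactor R x / max R ‖y‖) := by
      unfold radialFactor; field_simp
    have hm : |max R ‖y‖ - max R ‖x‖| ≤ ‖x - y‖ := by
      refine (abs_max_sub_max_le_max _ _ _ _).trans ?_
      rw [sub_self, abs_zero, max_eq_right (abs_nonneg _), norm_sub_rev]
      exact abs_norm_sub_norm_le _ _
    have hs := radialFactor_mem hR x
    rw [e, abs_mul, abs_of_nonneg (div_nonneg hs.1 hy.le), mul_assoc]
    have : radialFactor R x / max R ‖y‖ * ‖y‖ ≤ 1 := by
      rw [div_mul_eq_mul_div, div_le_one hy]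
      exact (mul_le_of_le_one_left (norm_nonneg _) hs.2).trans (le_max_right _ _)
    exact (mul_le_of_le_one_right (abs_nonneg _) this).trans hm
  have h2 : radialFactor R x • x - radialFactor R y • y
      = radialFactor R x • (x - y) + (radialFactor R x - radialFactor R y) • y := by
    module
  rw [dist_eq_norm, dist_eq_norm, h2]
  refine (norm_add_le _ _).trans ?_
  rw [norm_smul, norm_smul, Real.norm_of_nonneg (radialFactor_mem hR x).1, Real.norm_eq_abs]
  have := mul_le_of_le_one_left (norm_nonneg (x - y)) (radialFactor_mem hR x).2
  push_cast
  linarith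

theorem hasDerivWithinAt_Ici_of_Icc {w : ℝ → X} {w' : X} {T t : ℝ} (ht : t ∈ Ico 0 T)
    (h : HasDerivWithinAt w w' (Icc 0 T) t) : HasDerivWithinAt w w' (Ici t) t :=
  (h.mono_of_mem_nhdsWithin (by
    rw [mem_nhdsWithin]
    exact ⟨Iio T, isOpen_Iio, ht.2, fun s hs => ⟨ht.1.trans hs.2, hs.1.le⟩⟩))

/-- Existence on a bounded time interval for a locally Lipschitz perturbation of an isometry
group, given an a priori bound that is stable under scaling the argument of the perturbation. -/
theorem IsometryGroup.exists_solution_Icc [CompleteSpace X] (U : IsometryGroup X) {F : X → X}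
    (hF : ∀ R, ∃ K : ℝ≥0, LipschitzOnWith K F (closedBall 0 R)) (x₀ : X) {T B : ℝ} (hT : 0 ≤ T)
    (hB : ∀ (w : ℝ → X) (s : ℝ → ℝ), (∀ t, s t ∈ Icc (0 : ℝ) 1) → w 0 = x₀ →
      (∀ t ∈ Icc 0 T, HasDerivWithinAt w (U.op (-t) (F (s t • U.op t (w t)))) (Icc 0 T) t) →
      ∀ t ∈ Icc 0 T, ‖w t‖ ≤ B) :
    ∃ w : ℝ → X, w 0 = x₀ ∧
      ∀ t ∈ Icc 0 T, HasDerivWithinAt w (U.interaction F t (w t)) (Icc 0 T) t := by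
  -- The maximum with 1 only ensures a positive radius.
  set R : ℝ := max B 1
  have hR : 0 < R := lt_max_of_lt_right one_pos
  obtain ⟨K, hK⟩ := hF R
  -- The truncated perturbation is globally Lipschitz and bounded, and it agrees with F on the ball
  -- of radius R.
  set G : X → X := fun x => F (radialFactor R x • x)
  have hmem : ∀ x : X, radialFactor R x • x ∈ closedBall (0 : X) R := fun x => by
    simpa using norm_radialFactor_smul_le hR x
  have hG : LipschitzWith (K * 2) G := by
    rw [← lipschitzOnWith_univ]
    exact hK.comp (lipschitzWith_radialFactor_smul hR).lipschitzOnWith fun x _ => hmem x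
  set L : ℝ≥0 := ‖F 0‖₊ + K * ⟨R, hR.le⟩
  have hL : ∀ x, ‖G x‖ ≤ L := fun x => by
    have h := hK.norm_sub_le (hmem x) (mem_closedBall_self hR.le)
    rw [sub_zero] at h
    have h1 : ‖G x‖ ≤ ‖F 0‖ + ‖G x - F 0‖ := by
      simpa using norm_add_le (F 0) (G x - F 0)
    have h2 : (K : ℝ) * ‖radialFactor R x • x‖ ≤ K * R := by
      gcongr; exact norm_radialFactor_smul_le hR x
    have h3 : (L : ℝ) = ‖F 0‖ + K * R := rfl
    rw [h3]
    linarith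
  -- The speed is at most L everywhere, so the trajectory stays within L T of `x₀` and the interval
  -- [0, T] need not be shortened.
  have hP : IsPicardLindelof (U.interaction G) (tmin := 0) (tmax := T) ⟨0, left_mem_Icc.2 hT⟩ x₀
      (L * ⟨T, hT⟩) 0 L (K * 2) := by
    refine ⟨fun t _ => ?_, fun x _ => (U.continuous_interaction hG.continuous x).continuousOn,
      fun t _ x _ => ?_, ?_⟩
    · refine LipschitzOnWith.of_dist_le_mul fun x _ y _ => ?_
      have := hG.dist_le_mul (U.op t x) (U.op t y)
      rwa [(U.op t).dist_map, ← (U.op (-t)).dist_map] at this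
    · rw [IsometryGroup.interaction, LinearIsometry.norm_map]
      exact hL _
    · simp only [sub_zero, sub_self, max_eq_left hT, NNReal.coe_zero]
      exact le_rfl
  obtain ⟨w, hw0, hw⟩ := hP.exists_eq_forall_mem_Icc_hasDerivWithinAt₀
  -- The truncated equation is of the scaled form allowed in `hB`. Its solution therefore never
  -- leaves the ball of radius R, and the truncation is inactive along it.
  have hbd := hB w (fun t => radialFactor R (U.op t (w t))) (fun t => radialFactor_mem hR _) hw0 hw
  refine ⟨w, hw0, fun t ht => ?_⟩
  have h1 : ‖U.op t (w t)‖ ≤ R := by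
    rw [LinearIsometry.norm_map]
    exact (hbd t ht).trans (le_max_left _ _)
  have h2 := hw t ht
  simpa only [IsometryGroup.interaction, G, radialFactor_of_norm_le hR h1, one_smul] using h2

theorem exists_norm_le_of_hasDerivWithinAt {w : ℝ → X} {w' : ℝ → X} {T : ℝ}
    (hw : ∀ t ∈ Icc 0 T, HasDerivWithinAt w (w' t) (Icc 0 T) t) :
    ∃ R, ∀ t ∈ Icc 0 T, w t ∈ closedBall (0 : X) R := by
  have hc : ContinuousOn w (Icc 0 T) := fun t ht => (hw t ht).continuousWithinAt
  obtain ⟨R, hR⟩ := isCompact_Icc.exists_bound_of_continuousOn hc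
  exact ⟨R, fun t ht => by simpa using hR t ht⟩

/-- Solutions on all bounded time intervals of an equation with locally Lipschitz right-hand side
glue to a global solution. -/
theorem exists_global_solution {V : ℝ → X → X}
    (hV : ∀ R, ∃ K : ℝ≥0, ∀ t, LipschitzOnWith K (V t) (closedBall 0 R)) {x₀ : X}
    (h : ∀ T, 0 ≤ T → ∃ w : ℝ → X, w 0 = x₀ ∧
      ∀ t ∈ Icc 0 T, HasDerivWithinAt w (V t (w t)) (Icc 0 T) t) :
    ∃ w : ℝ → X, w 0 = x₀ ∧ ∀ t, 0 ≤ t → HasDerivWithinAt w (V t (w t)) (Ici 0) t := by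
  have huniq : ∀ T (w z : ℝ → X), w 0 = x₀ → z 0 = x₀ →
      (∀ t ∈ Icc 0 T, HasDerivWithinAt w (V t (w t)) (Icc 0 T) t) →
      (∀ t ∈ Icc 0 T, HasDerivWithinAt z (V t (z t)) (Icc 0 T) t) → EqOn w z (Icc 0 T) := by
    intro T w z hw0 hz0 hw hz
    obtain ⟨R₁, hR₁⟩ := exists_norm_le_of_hasDerivWithinAt hw
    obtain ⟨R₂, hR₂⟩ := exists_norm_le_of_hasDerivWithinAt hz
    obtain ⟨K, hK⟩ := hV (max R₁ R₂)
    refine ODE_solution_unique_of_mem_Icc_right (s := fun _ => closedBall 0 (max R₁ R₂))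
      (fun t _ => hK t) (fun t ht => (hw t ht).continuousWithinAt)
      (fun t ht => hasDerivWithinAt_Ici_of_Icc ht (hw t (Ico_subset_Icc_self ht)))
      (fun t ht => closedBall_subset_closedBall (le_max_left _ _) (hR₁ t (Ico_subset_Icc_self ht)))
      (fun t ht => (hz t ht).continuousWithinAt)
      (fun t ht => hasDerivWithinAt_Ici_of_Icc ht (hz t (Ico_subset_Icc_self ht)))
      (fun t ht => closedBall_subset_closedBall (le_max_right _ _) (hR₂ t (Ico_subset_Icc_self ht)))
      (hw0.trans hz0.symm)
  choose! W hW0 hW using h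
  have hcons : ∀ S T, 0 ≤ S → S ≤ T → EqOn (W S) (W T) (Icc 0 S) := fun S T hS hST =>
    huniq S _ _ (hW0 S hS) (hW0 T (hS.trans hST)) (hW S hS) fun t ht =>
      (hW T (hS.trans hST) t ⟨ht.1, ht.2.trans hST⟩).mono (Icc_subset_Icc_right hST)
  -- `W T` is the solution on [0, T]. Near t the diagonal agrees with `W (t + 1)`, for which t is
  -- not the right endpoint.
  refine ⟨fun t => W t t, hW0 0 le_rfl, fun t ht => ?_⟩
  have h1 := hW (t + 1) (by linarith) t ⟨ht, by linarith⟩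
  have h2 : HasDerivWithinAt (W (t + 1)) (V t (W (t + 1) t)) (Ici 0) t :=
    h1.mono_of_mem_nhdsWithin (by
      rw [mem_nhdsWithin]
      exact ⟨Iio (t + 1), isOpen_Iio, by simp, fun s hs => ⟨hs.2, hs.1.le⟩⟩)
  have e : W t t = W (t + 1) t := hcons t (t + 1) ht (by linarith) ⟨ht, le_rfl⟩
  simp only [e]
  refine h2.congr_of_eventuallyEq ?_ e
  rw [EventuallyEq, eventually_nhdsWithin_iff]
  filter_upwards [Iio_mem_nhds (show t < t + 1 by linarith)] with s hs hs0
  exact hcons s (t + 1) hs0 (le_of_lt hs) ⟨hs0, le_rfl⟩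

/-- A vector along which the orbit of the isometry group is Lipschitz at time zero. -/
def IsometryGroup.IsLipschitzVector (U : IsometryGroup X) (x : X) : Prop :=
  ∃ C, ∀ h ∈ Ioc (0 : ℝ) 1, ‖U.op h x - x‖ ≤ C * h

/-- Solutions starting from a Lipschitz vector pass through Lipschitz vectors only. -/
theorem IsometryGroup.isLipschitzVector_of_solution (U : IsometryGroup X) {F : X → X}
    (hF : ∀ R, ∃ K : ℝ≥0, LipschitzOnWith K F (closedBall 0 R)) {w : ℝ → X}
    (hw : ∀ t, 0 ≤ t → HasDerivWithinAt w (U.interaction F t (w t)) (Ici 0) t)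
    (h0 : U.IsLipschitzVector (w 0)) {T : ℝ} (hT : 0 ≤ T) :
    U.IsLipschitzVector (U.op T (w T)) := by
  -- The extra unit of time leaves room for the shifts h ≤ 1.
  have hIcc : ∀ t ∈ Icc 0 (T + 1), HasDerivWithinAt w (U.interaction F t (w t)) (Icc 0 (T + 1)) t :=
    fun t ht => (hw t ht.1).mono Icc_subset_Ici_self
  obtain ⟨R, hR⟩ := exists_norm_le_of_hasDerivWithinAt hIcc
  obtain ⟨K, hK⟩ := hF R
  have hR0 : 0 ≤ R := by
    have := hR 0 ⟨le_rfl, by linarith⟩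
    rw [mem_closedBall_zero_iff] at this
    exact (norm_nonneg _).trans this
  set L := ‖F 0‖ + K * R
  have hbd : ∀ t ∈ Icc 0 (T + 1), ‖U.interaction F t (w t)‖ ≤ L := fun t ht => by
    have hm : U.op t (w t) ∈ closedBall (0 : X) R := by simpa using hR t ht
    have h := hK.norm_sub_le hm (mem_closedBall_self hR0)
    rw [sub_zero] at h
    have h1 : ‖F (U.op t (w t))‖ ≤ ‖F 0‖ + ‖F (U.op t (w t)) - F 0‖ := by
      simpa using norm_add_le (F 0) (F (U.op t (w t)) - F 0)
    have h2 : (K : ℝ) * ‖U.op t (w t)‖ ≤ K * R := by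
      gcongr; simpa using hm
    rw [interaction, LinearIsometry.norm_map]
    simp only [L]
    linarith
  have hlip : ∀ s ∈ Icc 0 (T + 1), ∀ t ∈ Icc 0 (T + 1), ‖w t - w s‖ ≤ L * ‖t - s‖ :=
    fun s hs t ht => (convex_Icc 0 (T + 1)).norm_image_sub_le_of_norm_hasDerivWithin_le
      hIcc hbd hs ht
  obtain ⟨C, hC⟩ := h0
  -- The first term is the initial gap (C + L) h amplified by Grönwall's inequality; the second
  -- accounts for the motion of w between T and T + h.
  refine ⟨(C + L) * Real.exp (K * T) + L, fun h hh => ?_⟩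
  have hh0 : 0 ≤ h := hh.1.le
  -- This is the interaction picture of the time-shifted solution u(t + h). The equation for u is
  -- autonomous, so z and w solve the same equation.
  set z : ℝ → X := fun t => U.op h (w (t + h))
  have hz : ∀ t, 0 ≤ t → HasDerivWithinAt z (U.interaction F t (z t)) (Ici 0) t := fun t ht => by
    have h1 : HasDerivWithinAt (fun t => w (t + h)) (U.interaction F (t + h) (w (t + h)))
        (Ici 0) t := by
      have := (hw (t + h) (by linarith)).scomp (h := fun t => t + h) t
        ((hasDerivAt_id t).add_const h).hasDerivWithinAt
        (show MapsTo (fun t => t + h) (Ici 0) (Ici 0) from fun s hs => add_nonneg hs hh0)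
      simpa [Function.comp_def] using this
    have h2 := (U.op h).toContinuousLinearMap.hasFDerivAt.comp_hasDerivWithinAt t h1
    convert! h2 using 1
    simp only [interaction, z, LinearIsometry.coe_toContinuousLinearMap]
    rw [← U.op_add, ← U.op_add]
    congr 1
    ring_nf
  have key := dist_le_of_trajectories_ODE_of_mem (v := U.interaction F) (K := K) (f := z) (g := w)
    (a := 0) (b := T) (s := fun _ => closedBall 0 R) (δ := (C + L) * h)
    (fun t _ => U.lipschitzOnWith_interaction hK t)
    (fun t ht => (hz t ht.1).continuousWithinAt.mono Icc_subset_Ici_self)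
    (fun t ht => (hz t ht.1).mono (Ici_subset_Ici.2 ht.1))
    (fun t ht => by
      have := hR (t + h) ⟨by linarith [ht.1], by linarith [ht.2, hh.2]⟩
      simpa [z] using this)
    (fun t ht => (hw t ht.1).continuousWithinAt.mono Icc_subset_Ici_self)
    (fun t ht => (hw t ht.1).mono (Ici_subset_Ici.2 ht.1))
    (fun t ht => hR t ⟨ht.1, by linarith [ht.2]⟩)
    (by
      have e1 : z 0 - w 0 = U.op h (w h - w 0) + (U.op h (w 0) - w 0) := by
        simp only [z, zero_add, map_sub]; abel
      rw [dist_eq_norm, e1]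
      refine (norm_add_le _ _).trans ?_
      rw [LinearIsometry.norm_map]
      have := hlip 0 ⟨le_rfl, by linarith⟩ h ⟨hh0, by linarith [hh.2]⟩
      rw [sub_zero, Real.norm_of_nonneg hh0] at this
      linarith [hC h hh])
    T ⟨hT, le_rfl⟩
  rw [dist_eq_norm, sub_zero] at key
  have e2 : U.op h (U.op T (w T)) - U.op T (w T)
      = U.op T (z T - w T) - U.op (h + T) (w (T + h) - w T) := by
    simp only [z, map_sub, ← U.op_add]
    rw [add_comm T h]
    abel
  rw [e2]
  refine (norm_sub_le _ _).trans ?_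
  rw [LinearIsometry.norm_map, LinearIsometry.norm_map]
  have := hlip T ⟨hT, by linarith⟩ (T + h) ⟨by linarith, by linarith [hh.2]⟩
  rw [add_sub_cancel_left, Real.norm_of_nonneg hh0] at this
  linarith

/-- A product rule that requires the group to be differentiable only along the single vector `w t`:
the difference quotient of w passes through the group by joint continuity. -/
theorem IsometryGroup.hasDerivWithinAt_op_apply (U : IsometryGroup X) {w : ℝ → X} {w' x' : X}
    {s : Set ℝ} {t : ℝ} (hw : HasDerivWithinAt w w' s t)
    (hU : HasDerivAt (fun r => U.op r (w t)) x' t) :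
    HasDerivWithinAt (fun r => U.op r (w r)) (x' + U.op t w') s t := by
  have h1 := hasDerivWithinAt_iff_tendsto_slope.1 (hU.hasDerivWithinAt (s := s))
  have h2 := hasDerivWithinAt_iff_tendsto_slope.1 hw
  rw [hasDerivWithinAt_iff_tendsto_slope]
  have h3 := h1.add (U.tendsto_op_apply
    (tendsto_id.mono_left (nhdsWithin_le_nhds (s := s \ {t}))) h2)
  refine h3.congr fun r => ?_
  simp only [slope_def_module, id, map_smul, map_sub]
  module

end Abstract

/-! ### Multiplication operators on L² and the unitary groups of real symbols -/

theorem norm_sq_eq_integral (f : L2) : ‖f‖ ^ 2 = ∫ x, ‖f x‖ ^ 2 := by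
  have h := inner_self_eq_norm_sq_to_K (𝕜 := ℂ) f
  rw [L2.inner_def] at h
  simp_rw [inner_self_eq_norm_sq_to_K] at h
  norm_cast at h
  exact h.symm

/-- Dominated convergence to zero in `L²`. -/
theorem tendsto_L2_zero_of_dominated {ι : Type*} {l : Filter ι} [l.IsCountablyGenerated]
    {f : ι → L2} {q : ι → R3 → ℂ} {b : R3 → ℝ} (hb : MemLp b 2)
    (hfq : ∀ i, f i =ᵐ[volume] q i) (hq : ∀ᶠ i in l, ∀ᵐ x, ‖q i x‖ ≤ b x)
    (hlim : ∀ᵐ x, Tendsto (fun i => q i x) l (𝓝 0)) : Tendsto f l (𝓝 0) := by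
  have h : Tendsto (fun i => ∫ x, ‖q i x‖ ^ 2) l (𝓝 (∫ _ : R3, (0 : ℝ))) := by
    refine tendsto_integral_filter_of_dominated_convergence (fun x => b x ^ 2)
      (Eventually.of_forall fun i => ?_) ?_ hb.integrable_sq ?_
    · exact (((Lp.aestronglyMeasurable (f i)).congr (hfq i)).norm.pow 2)
    · filter_upwards [hq] with i hi
      filter_upwards [hi] with x hx
      rw [Real.norm_of_nonneg (by positivity)]
      gcongr
    · filter_upwards [hlim] with x hx
      simpa using hx.norm.pow 2
  rw [integral_zero] at h
  have h2 : Tendsto (fun i => ‖f i‖ ^ 2) l (𝓝 0) := by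
    refine h.congr fun i => ?_
    rw [norm_sq_eq_integral]
    refine integral_congr_ae ?_
    filter_upwards [hfq i] with x hx
    rw [hx]
  rw [tendsto_zero_iff_norm_tendsto_zero]
  have h3 := h2.sqrt
  simpa [Real.sqrt_sq] using h3

open Classical in
/-- Multiplication of an `L²` function by `q`, where the product is in `L²`. -/
noncomputable def mulL2 (q : R3 → ℂ) (f : L2) : L2 :=
  if h : MemLp (fun x => q x * f x) 2 volume then h.toLp else 0

theorem coeFn_mulL2 {q : R3 → ℂ} {f : L2} (h : MemLp (fun x => q x * f x) 2 volume) :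
    mulL2 q f =ᵐ[volume] fun x => q x * f x := by
  rw [mulL2, dif_pos h]
  exact h.coeFn_toLp

theorem memLp_mul_of_bound {q : R3 → ℂ} (hq : AEStronglyMeasurable q volume) {C : ℝ}
    (hC : ∀ x, ‖q x‖ ≤ C) (f : L2) : MemLp (fun x => q x * f x) 2 volume :=
  (Lp.memLp f).of_le_mul (c := C) (hq.mul (Lp.aestronglyMeasurable f)) (ae_of_all _ fun x => by
    rw [norm_mul]; gcongr; exact hC x)

theorem norm_mulL2_le {q : R3 → ℂ} (hq : AEStronglyMeasurable q volume) {C : ℝ}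
    (hC : ∀ x, ‖q x‖ ≤ C) (f : L2) : ‖mulL2 q f‖ ≤ C * ‖f‖ := by
  refine Lp.norm_le_mul_norm_of_ae_le_mul ?_
  filter_upwards [coeFn_mulL2 (memLp_mul_of_bound hq hC f)] with x hx
  rw [hx, norm_mul]
  gcongr
  exact hC x

/-- The unimodular function `e^{-i t a}`. -/
noncomputable def phaseFactor (a : R3 → ℝ) (t : ℝ) (k : R3) : ℂ :=
  Complex.exp ((-(t * a k) : ℝ) * Complex.I)

theorem norm_phaseFactor (a : R3 → ℝ) (t : ℝ) (k : R3) : ‖phaseFactor a t k‖ = 1 :=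
  Complex.norm_exp_ofReal_mul_I _

theorem measurable_phaseFactor {a : R3 → ℝ} (ha : Measurable a) (t : ℝ) :
    Measurable (phaseFactor a t) := by
  unfold phaseFactor; fun_prop

theorem phaseFactor_add (a : R3 → ℝ) (s t : ℝ) (k : R3) :
    phaseFactor a (s + t) k = phaseFactor a s k * phaseFactor a t k := by
  rw [phaseFactor, phaseFactor, phaseFactor, ← Complex.exp_add]
  congr 1
  push_cast
  ring

theorem hasDerivAt_phaseFactor (a : R3 → ℝ) (k : R3) :
    HasDerivAt (fun t => phaseFactor a t k) (-(a k * Complex.I)) 0 := by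
  have h1 : HasDerivAt (fun t : ℝ => ((-(t * a k) : ℝ) * Complex.I : ℂ)) (-(a k * Complex.I)) 0 := by
    have h := (((hasDerivAt_id (0 : ℝ)).mul_const (a k)).neg.ofReal_comp).mul_const Complex.I
    simpa using h
  simpa [phaseFactor] using h1.cexp

theorem norm_phaseFactor_sub_one_le (a : R3 → ℝ) (t : ℝ) (k : R3) :
    ‖phaseFactor a t k - 1‖ ≤ |t * a k| := by
  have h := Real.norm_exp_I_mul_ofReal_sub_one_le (x := -(t * a k))
  rw [mul_comm] at h
  simpa [phaseFactor] using h

section Phase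

variable {a : R3 → ℝ}

theorem memLp_phaseFactor_mul (ha : Measurable a) (t : ℝ) (f : L2) :
    MemLp (fun k => phaseFactor a t k * f k) 2 volume :=
  memLp_mul_of_bound (measurable_phaseFactor ha t).aestronglyMeasurable
    (fun k => (norm_phaseFactor a t k).le) f

/-- The unitary multiplication operator by `e^{-i t a}` on `L²`. -/
noncomputable def phase (ha : Measurable a) (t : ℝ) : L2 →ₗᵢ[ℂ] L2 where
  toFun f := mulL2 (phaseFactor a t) f
  map_add' f g := by
    refine Lp.ext ?_
    filter_upwards [coeFn_mulL2 (memLp_phaseFactor_mul ha t f),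
      coeFn_mulL2 (memLp_phaseFactor_mul ha t g), coeFn_mulL2 (memLp_phaseFactor_mul ha t (f + g)),
      Lp.coeFn_add f g, Lp.coeFn_add (mulL2 (phaseFactor a t) f) (mulL2 (phaseFactor a t) g)]
      with k h1 h2 h3 h4 h5
    rw [h3, h5, Pi.add_apply, h1, h2, h4, Pi.add_apply, mul_add]
  map_smul' c f := by
    refine Lp.ext ?_
    filter_upwards [coeFn_mulL2 (memLp_phaseFactor_mul ha t f),
      coeFn_mulL2 (memLp_phaseFactor_mul ha t (c • f)),
      Lp.coeFn_smul c f, Lp.coeFn_smul c (mulL2 (phaseFactor a t) f)] with k h1 h2 h3 h4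
    rw [h2, RingHom.id_apply, h4, Pi.smul_apply, h1, h3, Pi.smul_apply, smul_eq_mul, smul_eq_mul]
    ring
  norm_map' f := by
    have h := coeFn_mulL2 (memLp_phaseFactor_mul ha t f)
    refine le_antisymm (Lp.norm_le_norm_of_ae_le ?_) (Lp.norm_le_norm_of_ae_le ?_) <;>
    · filter_upwards [h] with k hk
      simp [hk, norm_phaseFactor]

theorem coeFn_phase (ha : Measurable a) (t : ℝ) (f : L2) :
    phase ha t f =ᵐ[volume] fun k => phaseFactor a t k * f k :=
  coeFn_mulL2 (memLp_phaseFactor_mul ha t f)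

theorem phase_zero (ha : Measurable a) (f : L2) : phase ha 0 f = f := by
  refine Lp.ext ?_
  filter_upwards [coeFn_phase ha 0 f] with k hk
  simp [hk, phaseFactor]

theorem phase_add (ha : Measurable a) (s t : ℝ) (f : L2) :
    phase ha (s + t) f = phase ha s (phase ha t f) := by
  refine Lp.ext ?_
  filter_upwards [coeFn_phase ha (s + t) f, coeFn_phase ha t f, coeFn_phase ha s (phase ha t f)]
    with k h1 h2 h3
  rw [h1, h3, h2, phaseFactor_add, mul_assoc]

theorem coeFn_phase_sub (ha : Measurable a) (t : ℝ) (f : L2) :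
    (phase ha t f - f : L2) =ᵐ[volume] fun k => (phaseFactor a t k - 1) * f k := by
  filter_upwards [coeFn_phase ha t f, Lp.coeFn_sub (phase ha t f) f] with k h1 h2
  rw [h2, Pi.sub_apply, h1]
  ring

theorem tendsto_phase_zero (ha : Measurable a) (f : L2) :
    Tendsto (fun t => phase ha t f) (𝓝 0) (𝓝 f) := by
  rw [← tendsto_sub_nhds_zero_iff]
  refine tendsto_L2_zero_of_dominated (b := fun k => 2 * ‖f k‖) ((Lp.memLp f).norm.const_mul 2)
    (fun t => coeFn_phase_sub ha t f) (Eventually.of_forall fun t => ae_of_all _ fun k => ?_)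
    (ae_of_all _ fun k => ?_)
  · rw [norm_mul]
    gcongr
    refine (norm_sub_le _ _).trans ?_
    rw [norm_phaseFactor, norm_one]
    norm_num
  · have h := (hasDerivAt_phaseFactor a k).continuousAt.tendsto
    have h0 : phaseFactor a 0 k = 1 := by simp [phaseFactor]
    rw [h0] at h
    simpa using (h.sub_const 1).mul_const (f k)

/-- The orbit of `f` is differentiable if `a f` is in `L²`. -/
theorem hasDerivAt_phase_zero (ha : Measurable a) {f : L2}
    (hf : MemLp (fun k => (a k : ℂ) * f k) 2 volume) :
    HasDerivAt (fun t => phase ha t f) (-(Complex.I • mulL2 (fun k => (a k : ℂ)) f)) 0 := by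
  rw [hasDerivAt_iff_tendsto_slope]
  rw [← tendsto_sub_nhds_zero_iff]
  refine tendsto_L2_zero_of_dominated (b := fun k => 2 * ‖(a k : ℂ) * f k‖) (hf.norm.const_mul 2)
    (q := fun t k => ((t⁻¹ : ℝ) * (phaseFactor a t k - 1) + a k * Complex.I) * f k)
    (fun t => ?_) ?_ (ae_of_all _ fun k => ?_)
  · rw [slope_def_module, phase_zero, sub_zero, sub_neg_eq_add]
    filter_upwards [coeFn_phase_sub ha t f, Lp.coeFn_add (t⁻¹ • (phase ha t f - f))
      (Complex.I • mulL2 (fun k => (a k : ℂ)) f), Lp.coeFn_smul t⁻¹ (phase ha t f - f),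
      Lp.coeFn_smul Complex.I (mulL2 (fun k => (a k : ℂ)) f), coeFn_mulL2 hf] with k h1 h2 h3 h4 h5
    rw [h2, Pi.add_apply, h3, h4, Pi.smul_apply, Pi.smul_apply, h1, h5, Complex.real_smul,
      smul_eq_mul]
    ring
  -- The difference quotient and its limit are each bounded by |a|, which explains the factor 2 in
  -- the dominating function.
  · filter_upwards [self_mem_nhdsWithin] with t ht
    have ht : |t| ≠ 0 := abs_ne_zero.2 ht
    refine ae_of_all _ fun k => ?_
    rw [norm_mul, norm_mul, ← mul_assoc]
    gcongr
    refine (norm_add_le _ _).trans ?_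
    rw [norm_mul, norm_mul, Complex.norm_I, mul_one, two_mul]
    gcongr
    have h := norm_phaseFactor_sub_one_le a t k
    rw [Complex.norm_real, Complex.norm_real, norm_inv, Real.norm_eq_abs, Real.norm_eq_abs]
    rw [abs_mul] at h
    rw [inv_mul_le_iff₀ (by positivity)]
    exact h
  · have h := hasDerivAt_iff_tendsto_slope.1 (hasDerivAt_phaseFactor a k)
    have h0 : phaseFactor a 0 k = 1 := by simp [phaseFactor]
    have h2 := (h.sub_const (-(a k * Complex.I))).mul_const (f k)
    rw [sub_self, zero_mul] at h2
    refine h2.congr fun t => ?_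
    rw [slope_def_module, h0, sub_zero, Complex.real_smul, sub_neg_eq_add]

/-- If the orbit of `f` is Lipschitz at time zero, then `a f` is in `L²`. -/
theorem memLp_mul_of_norm_phase_sub_le (ha : Measurable a) {f : L2} {C : ℝ}
    (hf : ∀ h ∈ Ioc (0 : ℝ) 1, ‖phase ha h f - f‖ ≤ C * h) :
    MemLp (fun k => (a k : ℂ) * f k) 2 volume := by
  have hm : AEStronglyMeasurable (fun k => (a k : ℂ) * f k) volume :=
    (Complex.measurable_ofReal.comp ha).aestronglyMeasurable.mul (Lp.aestronglyMeasurable f)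
  have hpos : ∀ n : ℕ, (0 : ℝ) < 1 / (n + 1) := fun n => by positivity
  -- These difference quotients at times 1/(n+1) are bounded by C in L² and converge pointwise to -i
  -- a f, so Fatou's lemma bounds the limit.
  set g : ℕ → L2 := fun n => ((1 / (n + 1) : ℝ)⁻¹) • (phase ha (1 / (n + 1)) f - f)
  have hg : ∀ n, eLpNorm (g n) 2 volume ≤ ENNReal.ofReal C := fun n => by
    rw [← Lp.enorm_def, ← ofReal_norm]
    refine ENNReal.ofReal_le_ofReal ?_
    rw [norm_smul, norm_inv, Real.norm_of_nonneg (hpos n).le, inv_mul_le_iff₀ (hpos n), mul_comm]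
    refine hf _ ⟨hpos n, ?_⟩
    rw [div_le_one (by positivity)]
    linarith [Nat.cast_nonneg (α := ℝ) n]
  have hgk : ∀ᵐ k, ∀ n, g n k = ((1 / (n + 1) : ℝ)⁻¹ : ℝ) *
      (phaseFactor a (1 / (n + 1)) k - 1) * f k := by
    rw [ae_all_iff]
    intro n
    filter_upwards [coeFn_phase_sub ha (1 / (n + 1)) f,
      Lp.coeFn_smul ((1 / (n + 1) : ℝ)⁻¹) (phase ha (1 / (n + 1)) f - f)] with k h1 h2
    rw [h2, Pi.smul_apply, h1, Complex.real_smul, mul_assoc]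
  have hlim : ∀ᵐ k, Tendsto (fun n => g n k) atTop (𝓝 (-(a k * Complex.I) * f k)) := by
    filter_upwards [hgk] with k hk
    have h := hasDerivAt_iff_tendsto_slope.1 (hasDerivAt_phaseFactor a k)
    have h0 : phaseFactor a 0 k = 1 := by simp [phaseFactor]
    have ht : Tendsto (fun n : ℕ => (1 / (n + 1) : ℝ)) atTop (𝓝[≠] 0) :=
      tendsto_nhdsWithin_iff.2 ⟨tendsto_one_div_add_atTop_nhds_zero_nat,
        Eventually.of_forall fun n => (hpos n).ne'⟩
    refine ((h.comp ht).mul_const (f k)).congr fun n => ?_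
    rw [hk, Function.comp_apply, slope_def_module, h0, sub_zero, Complex.real_smul]
  have hfat := Lp.eLpNorm_le_of_ae_tendsto (p := 2) (Eventually.of_forall hg)
    (fun n => Lp.aestronglyMeasurable (g n)) hlim
  refine ⟨hm, lt_of_le_of_lt (le_of_eq ?_) (hfat.trans_lt ENNReal.ofReal_lt_top)⟩
  refine eLpNorm_congr_norm_ae (ae_of_all _ fun k => ?_)
  simp

end Phase

/-! ### The Laplacian, H² and the free Schrödinger group on the Fourier side -/

/-- Compactly supported smooth functions are Schwartz functions and already separate locally
integrable functions, so a distributional identity is an almost everywhere identity. -/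
theorem coe_smulLeftCLM_eq_iff {q : R3 → ℂ} (hq : q.HasTemperateGrowth) (f g : L2) :
    smulLeftCLM ℂ q (Lp.toTemperedDistribution f) = Lp.toTemperedDistribution g ↔
      g =ᵐ[volume] fun x => q x * f x := by
  constructor
  · intro h
    have hf : LocallyIntegrable f volume := (Lp.memLp f).locallyIntegrable (by norm_num)
    refine ae_eq_of_integral_contDiff_smul_eq ((Lp.memLp g).locallyIntegrable (by norm_num))
      ?_ fun u hu hsupp => ?_
    · rw [← locallyIntegrableOn_univ]
      exact (locallyIntegrableOn_univ.2 hf).continuousOn_mul hq.1.continuous.continuousOn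
        isOpen_univ.isLocallyClosed
    · have hg₁ : HasCompactSupport (Complex.ofRealCLM ∘ u) := hsupp.comp_left rfl
      have hg₂ : ContDiff ℝ ∞ (Complex.ofRealCLM ∘ u) := by fun_prop
      have h2 := congrArg (fun T : 𝓢'(R3, ℂ) => T (hg₁.toSchwartzMap hg₂)) h
      simp only [smulLeftCLM_apply_apply, Lp.toTemperedDistribution_apply] at h2
      have h3 : ∫ x, u x • g x = ∫ x, (hg₁.toSchwartzMap hg₂) x • g x := by simp
      rw [h3, ← h2]
      refine integral_congr_ae (ae_of_all _ fun x => ?_)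
      simp [SchwartzMap.smulLeftCLM_apply_apply hq]
      ring
  · intro h
    ext u
    simp only [smulLeftCLM_apply_apply, Lp.toTemperedDistribution_apply]
    refine integral_congr_ae ?_
    filter_upwards [h] with x hx
    rw [hx, SchwartzMap.smulLeftCLM_apply_apply hq]
    simp only [smul_eq_mul]
    ring

/-- The transform `𝓕` on L² carries the kernel e^{-2πi x·ξ}, whence the factor (2π)² in the symbol.
-/
theorem isLaplacian_iff (f g : L2) :
    IsLaplacian f g ↔ (𝓕 g : L2) =ᵐ[volume]
      fun ξ => ((-((2 * Real.pi) ^ 2 * ‖ξ‖ ^ 2) : ℝ) : ℂ) * (𝓕 f : L2) ξ := by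
  have hq : (fun x : R3 => Complex.ofReal (‖x‖ ^ 2)).HasTemperateGrowth := by fun_prop
  have hq' : (fun ξ : R3 => ((-((2 * Real.pi) ^ 2 * ‖ξ‖ ^ 2) : ℝ) : ℂ)).HasTemperateGrowth := by
    fun_prop
  rw [← coe_smulLeftCLM_eq_iff hq', IsLaplacian, laplacian_eq_fourierMultiplierCLM,
    fourierMultiplierCLM_apply, ← Lp.fourier_toTemperedDistribution_eq,
    ← Lp.fourier_toTemperedDistribution_eq]
  have e : smulLeftCLM ℂ (fun ξ : R3 => ((-((2 * Real.pi) ^ 2 * ‖ξ‖ ^ 2) : ℝ) : ℂ))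
      = ((-(2 * Real.pi) ^ 2 : ℝ) : ℂ) • smulLeftCLM ℂ (fun x : R3 => Complex.ofReal (‖x‖ ^ 2)) := by
    rw [← smulLeftCLM_smul hq]
    congr 1
    ext ξ
    simp
  rw [e]
  generalize (smulLeftCLM ℂ (fun x : R3 => Complex.ofReal (‖x‖ ^ 2))) = S
  have e2 : ∀ (c : ℝ) (T : 𝓢'(R3, ℂ)), c • T = (c : ℂ) • T := fun c T => by
    ext u
    simp
  rw [e2, smul_apply, ← FourierTransform.fourierInv_smul]
  constructor
  · intro h
    rw [← h, fourier_fourierInv_eq]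
  · intro h
    rw [h, fourierInv_fourier_eq]

/-- The weights 1 + |ξ|² and |ξ|² differ by 1, and the transform of f is itself in L². -/
theorem memH2_iff (f : L2) :
    MemH2 f ↔ MemLp (fun ξ => ((‖ξ‖ ^ 2 : ℝ) : ℂ) * (𝓕 f : L2) ξ) 2 volume := by
  have hq : (fun x : R3 => (((1 + ‖x‖ ^ 2) ^ ((2 : ℝ) / 2) : ℝ) : ℂ)).HasTemperateGrowth := by
    fun_prop
  have h1 : ∀ x : R3, (((1 + ‖x‖ ^ 2) ^ ((2 : ℝ) / 2) : ℝ) : ℂ) = ((1 + ‖x‖ ^ 2 : ℝ) : ℂ) :=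
    fun x => by norm_num
  rw [MemH2, memSobolev_iff_exists_smulLeftCLM_fourier, Lp.fourier_toTemperedDistribution_eq]
  simp_rw [coe_smulLeftCLM_eq_iff hq, h1]
  constructor
  · rintro ⟨g, hg⟩
    refine ((Lp.memLp g).sub (Lp.memLp (𝓕 f : L2))).ae_eq ?_
    filter_upwards [hg] with ξ hξ
    rw [Pi.sub_apply, hξ]
    push_cast
    ring
  · intro h
    refine ⟨(h.add (Lp.memLp (𝓕 f : L2))).toLp, ?_⟩
    filter_upwards [(h.add (Lp.memLp (𝓕 f : L2))).coeFn_toLp] with ξ hξ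
    rw [hξ, Pi.add_apply]
    push_cast
    ring

theorem inner_mulReal_comm {f₁ f₂ g₁ g₂ : L2} {a : R3 → ℝ}
    (h₁ : g₁ =ᵐ[volume] fun x => (a x : ℂ) * f₁ x)
    (h₂ : g₂ =ᵐ[volume] fun x => (a x : ℂ) * f₂ x) : inner ℂ g₁ f₂ = inner ℂ f₁ g₂ := by
  rw [L2.inner_def, L2.inner_def]
  refine integral_congr_ae ?_
  filter_upwards [h₁, h₂] with x hx hy
  rw [hx, hy]
  simp only [RCLike.inner_apply, map_mul, Complex.conj_ofReal]
  ring

/-- The Laplacian is symmetric. -/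
theorem IsLaplacian.inner_comm {f₁ f₂ g₁ g₂ : L2} (h₁ : IsLaplacian f₁ g₁)
    (h₂ : IsLaplacian f₂ g₂) : inner ℂ g₁ f₂ = inner ℂ f₁ g₂ := by
  rw [← Lp.inner_fourier_eq g₁ f₂, ← Lp.inner_fourier_eq f₁ g₂]
  exact inner_mulReal_comm ((isLaplacian_iff f₁ g₁).1 h₁) ((isLaplacian_iff f₂ g₂).1 h₂)

/-- The symbol of `-c Δ`. -/
noncomputable def kineticSymbol (c : ℝ) (ξ : R3) : ℝ := c * ((2 * Real.pi) ^ 2 * ‖ξ‖ ^ 2)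

theorem measurable_kineticSymbol (c : ℝ) : Measurable (kineticSymbol c) := by
  unfold kineticSymbol; fun_prop

/-- The unitary group `e^{i t c Δ}` of the free Schrödinger equation. -/
noncomputable def freeEvolution (c t : ℝ) : L2 →ₗᵢ[ℂ] L2 :=
  (Lp.fourierTransformₗᵢ R3 ℂ).symm.toLinearIsometry.comp
    ((phase (measurable_kineticSymbol c) t).comp (Lp.fourierTransformₗᵢ R3 ℂ).toLinearIsometry)

theorem freeEvolution_apply (c t : ℝ) (f : L2) :
    freeEvolution c t f = 𝓕⁻ (phase (measurable_kineticSymbol c) t (𝓕 f)) := rfl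

theorem fourier_freeEvolution (c t : ℝ) (f : L2) :
    𝓕 (freeEvolution c t f) = phase (measurable_kineticSymbol c) t (𝓕 f) := by
  rw [freeEvolution_apply, fourier_fourierInv_eq]

theorem freeEvolution_zero (c : ℝ) (f : L2) : freeEvolution c 0 f = f := by
  rw [freeEvolution_apply, phase_zero, fourierInv_fourier_eq]

theorem freeEvolution_add (c s t : ℝ) (f : L2) :
    freeEvolution c (s + t) f = freeEvolution c s (freeEvolution c t f) := by
  rw [freeEvolution_apply, phase_add, freeEvolution_apply c s, fourier_freeEvolution]

theorem tendsto_freeEvolution_zero (c : ℝ) (f : L2) :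
    Tendsto (fun t => freeEvolution c t f) (𝓝 0) (𝓝 f) := by
  have h := ((Lp.fourierTransformₗᵢ R3 ℂ).symm.continuous.tendsto _).comp
    (tendsto_phase_zero (measurable_kineticSymbol c) (𝓕 f))
  have e : (Lp.fourierTransformₗᵢ R3 ℂ).symm (𝓕 f) = f :=
    (Lp.fourierTransformₗᵢ R3 ℂ).symm_apply_apply f
  rwa [e] at h

theorem memLp_kineticSymbol_mul_iff {c : ℝ} (hc : c ≠ 0) (f : L2) :
    MemLp (fun ξ => (kineticSymbol c ξ : ℂ) * f ξ) 2 volume ↔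
      MemLp (fun ξ => ((‖ξ‖ ^ 2 : ℝ) : ℂ) * f ξ) 2 volume := by
  have hd : ((c * (2 * Real.pi) ^ 2 : ℝ) : ℂ) ≠ 0 := by
    rw [Complex.ofReal_ne_zero]
    have := Real.pi_pos
    positivity
  constructor
  · intro h
    refine (h.const_mul (((c * (2 * Real.pi) ^ 2 : ℝ) : ℂ)⁻¹)).ae_eq (ae_of_all _ fun ξ => ?_)
    simp only [kineticSymbol]
    rw [inv_mul_eq_iff_eq_mul₀ hd]
    push_cast
    ring
  · intro h
    refine (h.const_mul ((c * (2 * Real.pi) ^ 2 : ℝ) : ℂ)).ae_eq (ae_of_all _ fun ξ => ?_)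
    simp only [kineticSymbol]
    push_cast
    ring

/-- Along `H²` functions the free evolution is differentiable, with the expected derivative. -/
theorem exists_isLaplacian_hasDerivAt_freeEvolution {c : ℝ} (hc : c ≠ 0) {f : L2} (hf : MemH2 f) :
    ∃ g, IsLaplacian f g ∧ HasDerivAt (fun t => freeEvolution c t f) ((Complex.I * c) • g) 0 := by
  have h1 := (memH2_iff f).1 hf
  have h2 := (memLp_kineticSymbol_mul_iff hc (𝓕 f)).2 h1
  have h3 := hasDerivAt_phase_zero (measurable_kineticSymbol c) h2
  have hc' : (c : ℂ) ≠ 0 := Complex.ofReal_ne_zero.2 hc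
  set M : L2 := mulL2 (fun ξ => (kineticSymbol c ξ : ℂ)) (𝓕 f)
  -- M is the transform of -cΔf, so this witness is Δf.
  refine ⟨𝓕⁻ (-((c : ℂ)⁻¹ • M)), ?_, ?_⟩
  · rw [isLaplacian_iff, fourier_fourierInv_eq]
    filter_upwards [coeFn_mulL2 h2, Lp.coeFn_neg ((c : ℂ)⁻¹ • M), Lp.coeFn_smul (c : ℂ)⁻¹ M]
      with ξ e1 e2 e3
    rw [e2, Pi.neg_apply, e3, Pi.smul_apply, e1, smul_eq_mul]
    simp only [kineticSymbol]
    push_cast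
    field_simp
  · have h4 := ((Lp.fourierTransformₗᵢ R3 ℂ).symm.toContinuousLinearEquiv.toContinuousLinearMap.restrictScalars
      ℝ).hasFDerivAt.comp_hasDerivAt 0 h3
    convert! h4 using 1
    change (Complex.I * c) • 𝓕⁻ (-((c : ℂ)⁻¹ • M)) = 𝓕⁻ (-(Complex.I • M))
    rw [← FourierTransform.fourierInv_smul]
    congr 1
    rw [smul_neg, smul_smul, mul_assoc, mul_inv_cancel₀ hc', mul_one]

/-- Plancherel carries the Lipschitz bound over to the phase group, where the Fatou argument
applies. -/
theorem memH2_of_norm_freeEvolution_sub_le {c : ℝ} (hc : c ≠ 0) {f : L2} {C : ℝ}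
    (hf : ∀ h ∈ Ioc (0 : ℝ) 1, ‖freeEvolution c h f - f‖ ≤ C * h) : MemH2 f := by
  rw [memH2_iff, ← memLp_kineticSymbol_mul_iff hc]
  refine memLp_mul_of_norm_phase_sub_le (measurable_kineticSymbol c) (C := C) fun h hh => ?_
  have e : 𝓕 (freeEvolution c h f - f) = phase (measurable_kineticSymbol c) h (𝓕 f) - 𝓕 f := by
    rw [← fourier_freeEvolution]
    exact (Lp.fourierTransformₗᵢ R3 ℂ).map_sub _ _
  rw [← e, Lp.norm_fourier_eq]
  exact hf h hh

/-! ### Estimates for the form factor, the field and the source -/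

theorem integrable_norm_mul_norm (f g : L2) : Integrable fun x => ‖f x‖ * ‖g x‖ :=
  (Lp.memLp f).norm.integrable_mul (Lp.memLp g).norm

/-- The Cauchy–Schwarz inequality. -/
theorem integral_norm_mul_norm_le (f g : L2) : ∫ x, ‖f x‖ * ‖g x‖ ≤ ‖f‖ * ‖g‖ := by
  set F : Lp ℝ 2 (volume : Measure R3) := (Lp.memLp f).norm.toLp
  set G : Lp ℝ 2 (volume : Measure R3) := (Lp.memLp g).norm.toLp
  have hF := (Lp.memLp f).norm.coeFn_toLp
  have hG := (Lp.memLp g).norm.coeFn_toLp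
  have h1 : ∫ x, ‖f x‖ * ‖g x‖ = inner ℝ F G := by
    rw [L2.inner_def]
    refine integral_congr_ae ?_
    filter_upwards [hF, hG] with x hx hy
    rw [hx, hy]
    simp [mul_comm]
  have h2 : ‖F‖ ≤ ‖f‖ := Lp.norm_le_norm_of_ae_le (by filter_upwards [hF] with x hx; simp [F, hx])
  have h3 : ‖G‖ ≤ ‖g‖ := Lp.norm_le_norm_of_ae_le (by filter_upwards [hG] with x hx; simp [G, hx])
  rw [h1]
  exact (real_inner_le_norm F G).trans (by gcongr)

theorem mulL2_sub_right {q : R3 → ℂ} (hq : AEStronglyMeasurable q volume) {C : ℝ}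
    (hC : ∀ x, ‖q x‖ ≤ C) (f g : L2) : mulL2 q (f - g) = mulL2 q f - mulL2 q g := by
  refine Lp.ext ?_
  filter_upwards [coeFn_mulL2 (memLp_mul_of_bound hq hC f), coeFn_mulL2 (memLp_mul_of_bound hq hC g),
    coeFn_mulL2 (memLp_mul_of_bound hq hC (f - g)), Lp.coeFn_sub f g,
    Lp.coeFn_sub (mulL2 q f) (mulL2 q g)] with x h1 h2 h3 h4 h5
  rw [h3, h5, Pi.sub_apply, h1, h2, h4, Pi.sub_apply, mul_sub]

theorem mulL2_sub_left {p q : R3 → ℂ} (hp : AEStronglyMeasurable p volume)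
    (hq : AEStronglyMeasurable q volume) {B C D : ℝ} (hB : ∀ x, ‖p x‖ ≤ B) (hC : ∀ x, ‖q x‖ ≤ C)
    (hD : ∀ x, ‖p x - q x‖ ≤ D) (f : L2) : ‖mulL2 p f - mulL2 q f‖ ≤ D * ‖f‖ := by
  refine Lp.norm_le_mul_norm_of_ae_le_mul ?_
  filter_upwards [coeFn_mulL2 (memLp_mul_of_bound hp hB f), coeFn_mulL2 (memLp_mul_of_bound hq hC f),
    Lp.coeFn_sub (mulL2 p f) (mulL2 q f)] with x h1 h2 h3
  rw [h3, Pi.sub_apply, h1, h2, ← sub_mul, norm_mul]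
  gcongr
  exact hD x

theorem norm_planeWave (k x : R3) : ‖planeWave k x‖ = 1 := by
  rw [planeWave, mul_comm]
  exact Complex.norm_exp_ofReal_mul_I _

theorem conj_planeWave (k x : R3) : (starRingEnd ℂ) (planeWave k x) = planeWave (-k) x := by
  rw [planeWave, planeWave, ← Complex.exp_conj, map_mul, Complex.conj_I, Complex.conj_ofReal,
    inner_neg_left]
  push_cast
  ring_nf

theorem continuous_planeWave : Continuous fun p : R3 × R3 => planeWave p.1 p.2 := by
  unfold planeWave
  fun_prop

section FormFactor

variable (m Λ : ℝ)

theorem omega_nonneg (k : R3) : 0 ≤ omega m k := Real.sqrt_nonneg _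

theorem measurable_omega : Measurable (omega m) := by
  unfold omega; fun_prop

theorem eta_nonneg (k : R3) : 0 ≤ eta m Λ k := by
  unfold eta
  split_ifs
  · have := Real.pi_pos
    positivity
  · exact le_rfl

theorem measurable_eta : Measurable (eta m Λ) := by
  unfold eta
  refine Measurable.ite (measurableSet_le measurable_norm measurable_const) ?_ measurable_const
  exact measurable_const.div (((measurable_omega m).const_mul 2).sqrt)

/-- In polar coordinates |η|² becomes a constant times r²/(2ω) on (0, Λ]. Since r ≤ ω this is
bounded, also for m = 0, where η is singular at the origin. -/
theorem memLp_eta : MemLp (fun k => (eta m Λ k : ℂ)) 2 volume := by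
  have hm : AEStronglyMeasurable (fun k => (eta m Λ k : ℂ)) volume :=
    (Complex.measurable_ofReal.comp (measurable_eta m Λ)).aestronglyMeasurable
  rw [← memLp_norm_iff hm, memLp_two_iff_integrable_sq hm.norm]
  set c : ℝ := (2 * Real.pi) ^ (-3 / 2 : ℝ)
  have hf : Measurable fun r : ℝ => if r ≤ Λ then c ^ 2 / (2 * √(r ^ 2 + m ^ 2)) else 0 :=
    Measurable.ite (measurableSet_le measurable_id measurable_const) (by fun_prop) measurable_const
  have e : ∀ k : R3, ‖(eta m Λ k : ℂ)‖ ^ 2 =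
      (fun r : ℝ => if r ≤ Λ then c ^ 2 / (2 * √(r ^ 2 + m ^ 2)) else 0) ‖k‖ := fun k => by
    rw [Complex.norm_real, Real.norm_eq_abs, sq_abs]
    simp only [eta]
    split_ifs with h
    · rw [div_pow, Real.sq_sqrt (by have := omega_nonneg m k; positivity), omega]
    · simp
  refine (integrable_congr (ae_of_all _ e)).2 ((integrable_fun_norm_addHaar volume
    (f := fun r : ℝ => if r ≤ Λ then c ^ 2 / (2 * √(r ^ 2 + m ^ 2)) else 0)).2 ?_)
  have hd : Module.finrank ℝ R3 - 1 = 2 := by simp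
  rw [hd]
  have hdom : IntegrableOn (fun _ : ℝ => c ^ 2 * Λ) (Ioc 0 Λ) :=
    integrableOn_const measure_Ioc_lt_top.ne
  have hz : IntegrableOn (fun r : ℝ =>
      r ^ 2 • (if r ≤ Λ then c ^ 2 / (2 * √(r ^ 2 + m ^ 2)) else 0)) (Ioc 0 Λ) := by
    refine hdom.mono' ((measurable_id.pow_const 2).smul hf).aestronglyMeasurable ?_
    refine (ae_restrict_iff' measurableSet_Ioc).2 (ae_of_all _ fun r hr => ?_)
    have hr0 : 0 < r := hr.1
    have hs : r ≤ √(r ^ 2 + m ^ 2) := Real.le_sqrt_of_sq_le (by nlinarith [sq_nonneg m])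
    rw [if_pos hr.2, smul_eq_mul, Real.norm_of_nonneg (by positivity), mul_div_assoc',
      div_le_iff₀ (by linarith)]
    have h1 : r * r ≤ Λ * (2 * √(r ^ 2 + m ^ 2)) :=
      mul_le_mul hr.2 (by linarith) hr0.le (hr0.le.trans hr.2)
    calc r ^ 2 * c ^ 2 = c ^ 2 * (r * r) := by ring
      _ ≤ c ^ 2 * (Λ * (2 * √(r ^ 2 + m ^ 2))) := by gcongr
      _ = _ := by ring
  have hcomp : Integrable ((Ioc 0 Λ).indicator (fun r : ℝ =>
      r ^ 2 • (if r ≤ Λ then c ^ 2 / (2 * √(r ^ 2 + m ^ 2)) else 0))) :=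
    hz.integrable_indicator measurableSet_Ioc
  refine (hcomp.integrableOn (s := Ioi 0)).congr_fun (fun r hr => ?_) measurableSet_Ioi
  by_cases h : r ≤ Λ
  · rw [indicator_of_mem (show r ∈ Ioc 0 Λ from ⟨hr, h⟩)]
  · rw [indicator_of_notMem fun h' : r ∈ Ioc 0 Λ => h h'.2]
    simp [h]

/-- The form factor as an element of `L²`. -/
noncomputable def etaL2 : L2 := (memLp_eta m Λ).toLp

theorem coeFn_etaL2 : etaL2 m Λ =ᵐ[volume] fun k => (eta m Λ k : ℂ) := (memLp_eta m Λ).coeFn_toLp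

end FormFactor

section Field

variable (m Λ : ℝ) (α β : L2)

/-- The integrand of the field. -/
noncomputable def fieldIntegrand (x k : R3) : ℂ :=
  (eta m Λ k : ℂ) * (planeWave k x * α k + planeWave (-k) x * (starRingEnd ℂ) (α k))

theorem integrable_eta_mul_norm : Integrable fun k => 2 * (eta m Λ k * ‖α k‖) := by
  refine (((integrable_norm_mul_norm (etaL2 m Λ) α).congr ?_).const_mul 2)
  filter_upwards [coeFn_etaL2 m Λ] with k hk
  rw [hk, Complex.norm_real, Real.norm_of_nonneg (eta_nonneg m Λ k)]

theorem norm_fieldIntegrand_le (x k : R3) :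
    ‖fieldIntegrand m Λ α x k‖ ≤ 2 * (eta m Λ k * ‖α k‖) := by
  have h := norm_add_le (planeWave k x * α k) (planeWave (-k) x * (starRingEnd ℂ) (α k))
  rw [norm_mul, norm_mul, norm_planeWave, norm_planeWave, RCLike.norm_conj] at h
  rw [fieldIntegrand, norm_mul, Complex.norm_real, Real.norm_of_nonneg (eta_nonneg m Λ k)]
  nlinarith [eta_nonneg m Λ k]

theorem aestronglyMeasurable_fieldIntegrand (x : R3) :
    AEStronglyMeasurable (fieldIntegrand m Λ α x) volume := by
  have h1 : Measurable fun k : R3 => planeWave k x :=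
    (continuous_planeWave.comp (Continuous.prodMk_left x)).measurable
  have h2 : Measurable fun k : R3 => planeWave (-k) x := h1.comp measurable_neg
  exact (Complex.measurable_ofReal.comp (measurable_eta m Λ)).aestronglyMeasurable.mul
    ((h1.aestronglyMeasurable.mul (Lp.aestronglyMeasurable α)).add
      (h2.aestronglyMeasurable.mul
        (Complex.continuous_conj.comp_aestronglyMeasurable (Lp.aestronglyMeasurable α))))

theorem integrable_fieldIntegrand (x : R3) : Integrable (fieldIntegrand m Λ α x) :=
  (integrable_eta_mul_norm m Λ α).mono' (aestronglyMeasurable_fieldIntegrand m Λ α x)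
    (ae_of_all _ fun k => norm_fieldIntegrand_le m Λ α x k)

/-- Plane waves have modulus one, so Cauchy–Schwarz in k gives a bound uniform in x; the potential
is a bounded multiplication operator. -/
theorem norm_field_le (x : R3) : ‖field m Λ α x‖ ≤ 2 * ‖etaL2 m Λ‖ * ‖α‖ := by
  refine (norm_integral_le_of_norm_le (integrable_eta_mul_norm m Λ α)
    (ae_of_all _ fun k => norm_fieldIntegrand_le m Λ α x k)).trans ?_
  rw [integral_const_mul, mul_assoc]
  refine mul_le_mul_of_nonneg_left (le_trans (le_of_eq (integral_congr_ae ?_))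
    (integral_norm_mul_norm_le (etaL2 m Λ) α)) two_pos.le
  filter_upwards [coeFn_etaL2 m Λ] with k hk
  rw [hk, Complex.norm_real, Real.norm_of_nonneg (eta_nonneg m Λ k)]

theorem continuous_field : Continuous (field m Λ α) := by
  refine continuous_of_dominated (fun x => aestronglyMeasurable_fieldIntegrand m Λ α x)
    (fun x => ae_of_all _ fun k => norm_fieldIntegrand_le m Λ α x k) (integrable_eta_mul_norm m Λ α)
    (ae_of_all _ fun k => ?_)
  have h1 : ∀ k : R3, Continuous fun x : R3 => planeWave k x := fun k =>
    continuous_planeWave.comp (Continuous.prodMk_right k)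
  exact continuous_const.mul (((h1 k).mul continuous_const).add ((h1 (-k)).mul continuous_const))

theorem field_sub (x : R3) : field m Λ (α - β) x = field m Λ α x - field m Λ β x := by
  refine Eq.trans (integral_congr_ae ?_) (integral_sub (integrable_fieldIntegrand m Λ α x)
    (integrable_fieldIntegrand m Λ β x))
  filter_upwards [Lp.coeFn_sub α β] with k hk
  simp only [hk, Pi.sub_apply, map_sub]
  ring

/-- The field is real-valued. -/
theorem field_eq_ofReal (x : R3) : ∃ r : ℝ, field m Λ α x = r := by
  refine ⟨∫ k, 2 * eta m Λ k * (planeWave k x * α k).re, ?_⟩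
  rw [field, ← integral_complex_ofReal]
  refine integral_congr_ae (ae_of_all _ fun k => ?_)
  have h := Complex.add_conj (planeWave k x * α k)
  rw [map_mul, conj_planeWave] at h
  simp only [h]
  push_cast
  ring

end Field

section Source

theorem integrable_density {N : ℕ} (φ : Fin N → L2) : Integrable (density φ) := by
  unfold density
  exact integrable_finsetSum _ fun j _ => (Lp.memLp (φ j)).norm.integrable_sq

/-- Factor |a|² - |b|² = (|a| - |b|)(|a| + |b|) and apply Cauchy–Schwarz: the density is locally
Lipschitz from L² to L¹. -/
theorem integral_abs_density_sub_le {N : ℕ} (φ ψ : Fin N → L2) :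
    ∫ x, |density φ x - density ψ x| ≤ ∑ j, ‖φ j - ψ j‖ * (‖φ j‖ + ‖ψ j‖) := by
  have hi : ∀ j, Integrable fun x => ‖(φ j - ψ j) x‖ * ‖φ j x‖ + ‖(φ j - ψ j) x‖ * ‖ψ j x‖ :=
    fun j => (integrable_norm_mul_norm _ _).add (integrable_norm_mul_norm _ _)
  have hs : ∀ᵐ x, ∀ j, (φ j - ψ j : L2) x = φ j x - ψ j x := by
    rw [ae_all_iff]
    exact fun j => Lp.coeFn_sub (φ j) (ψ j)
  calc ∫ x, |density φ x - density ψ x|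
      ≤ ∫ x, ∑ j, (‖(φ j - ψ j) x‖ * ‖φ j x‖ + ‖(φ j - ψ j) x‖ * ‖ψ j x‖) := by
        refine integral_mono_ae ((integrable_density φ).sub (integrable_density ψ)).abs
          (integrable_finsetSum _ fun j _ => hi j) ?_
        filter_upwards [hs] with x hx
        simp only [density]
        rw [← Finset.sum_sub_distrib]
        refine (Finset.abs_sum_le_sum_abs _ _).trans (Finset.sum_le_sum fun j _ => ?_)
        rw [hx, sq_sub_sq, abs_mul, ← mul_add, abs_of_nonneg (by positivity), mul_comm]
        gcongr
        exact abs_norm_sub_norm_le _ _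
    _ = ∑ j, ∫ x, (‖(φ j - ψ j) x‖ * ‖φ j x‖ + ‖(φ j - ψ j) x‖ * ‖ψ j x‖) :=
        integral_finsetSum _ fun j _ => hi j
    _ ≤ _ := by
        refine Finset.sum_le_sum fun j _ => ?_
        rw [integral_add (integrable_norm_mul_norm _ _) (integrable_norm_mul_norm _ _), mul_add]
        exact add_le_add (integral_norm_mul_norm_le _ _) (integral_norm_mul_norm_le _ _)

theorem integral_abs_density {N : ℕ} (φ : Fin N → L2) :
    ∫ x, |density φ x| = ∑ j, ‖φ j‖ ^ 2 := by
  have h : ∀ x, |density φ x| = ∑ j, ‖φ j x‖ ^ 2 := fun x =>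
    abs_of_nonneg (Finset.sum_nonneg fun j _ => by positivity)
  simp_rw [h, norm_sq_eq_integral]
  exact integral_finsetSum _ fun j _ => (Lp.memLp (φ j)).norm.integrable_sq

theorem norm_planeWave_mul (f : R3 → ℝ) (k x : R3) : ‖planeWave (-k) x * (f x : ℂ)‖ = |f x| := by
  rw [norm_mul, norm_planeWave, one_mul, Complex.norm_real, Real.norm_eq_abs]

theorem aestronglyMeasurable_planeWave_mul {f : R3 → ℝ} (hf : Integrable f) (k : R3) :
    AEStronglyMeasurable (fun x => planeWave (-k) x * (f x : ℂ)) volume :=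
  (continuous_planeWave.comp (Continuous.prodMk_right (-k))).aestronglyMeasurable.mul
    hf.ofReal.aestronglyMeasurable

theorem integrable_planeWave_mul {f : R3 → ℝ} (hf : Integrable f) (k : R3) :
    Integrable fun x => planeWave (-k) x * (f x : ℂ) :=
  hf.abs.mono' (aestronglyMeasurable_planeWave_mul hf k)
    (ae_of_all _ fun x => (norm_planeWave_mul f k x).le)

theorem norm_fourierT_le (f : R3 → ℝ) (k : R3) :
    ‖fourierT f k‖ ≤ (2 * Real.pi) ^ (-3 / 2 : ℝ) * ∫ x, |f x| := by
  have hp := Real.pi_pos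
  rw [fourierT, norm_mul, Complex.norm_real, Real.norm_of_nonneg (by positivity)]
  gcongr
  refine (norm_integral_le_integral_norm _).trans (le_of_eq ?_)
  simp_rw [norm_planeWave_mul]

theorem continuous_fourierT {f : R3 → ℝ} (hf : Integrable f) : Continuous (fourierT f) := by
  refine continuous_const.mul (continuous_of_dominated
    (fun k => aestronglyMeasurable_planeWave_mul hf k)
    (fun k => ae_of_all _ fun x => (norm_planeWave_mul f k x).le) hf.abs (ae_of_all _ fun x => ?_))
  exact (continuous_planeWave.comp (continuous_neg.prodMk continuous_const)).mul continuous_const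

theorem fourierT_sub {f g : R3 → ℝ} (hf : Integrable f) (hg : Integrable g) (k : R3) :
    fourierT f k - fourierT g k = fourierT (fun x => f x - g x) k := by
  simp only [fourierT]
  rw [← mul_sub, ← integral_sub (integrable_planeWave_mul hf k) (integrable_planeWave_mul hg k)]
  congr 2
  ext x
  push_cast
  ring

end Source

/-! ### The nonlinearity is Lipschitz on balls -/

/-- The semiclassical factor `N^{-1/3}`. -/
noncomputable def semiclassical (N : ℕ) : ℝ := (N : ℝ) ^ (-1 / 3 : ℝ)

theorem semiclassical_pos {N : ℕ} (hN : 1 ≤ N) : 0 < semiclassical N :=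
  Real.rpow_pos_of_pos (by exact_mod_cast hN) _

theorem semiclassical_mul_self {N : ℕ} (hN : 1 ≤ N) :
    semiclassical N * semiclassical N = (N : ℝ) ^ (-2 / 3 : ℝ) := by
  rw [semiclassical, ← Real.rpow_add (by exact_mod_cast hN)]
  norm_num

section Potential

variable (m Λ : ℝ)

theorem memLp_field_mul (α φ : L2) : MemLp (fun x => field m Λ α x * φ x) 2 volume :=
  memLp_mul_of_bound (continuous_field m Λ α).aestronglyMeasurable (norm_field_le m Λ α) φ

theorem norm_field_mul_sub_le (α β φ ψ : L2) :
    ‖mulL2 (field m Λ α) φ - mulL2 (field m Λ β) ψ‖ ≤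
      2 * ‖etaL2 m Λ‖ * ‖α‖ * ‖φ - ψ‖ + 2 * ‖etaL2 m Λ‖ * ‖α - β‖ * ‖ψ‖ := by
  have hα := (continuous_field m Λ α).aestronglyMeasurable (μ := volume)
  have hβ := (continuous_field m Λ β).aestronglyMeasurable (μ := volume)
  have e : mulL2 (field m Λ α) φ - mulL2 (field m Λ β) ψ =
      mulL2 (field m Λ α) (φ - ψ) + (mulL2 (field m Λ α) ψ - mulL2 (field m Λ β) ψ) := by
    rw [mulL2_sub_right hα (norm_field_le m Λ α)]
    abel
  rw [e]
  refine (norm_add_le _ _).trans (add_le_add (norm_mulL2_le hα (norm_field_le m Λ α) _) ?_)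
  refine mulL2_sub_left hα hβ (norm_field_le m Λ α) (norm_field_le m Λ β) (fun x => ?_) ψ
  rw [← field_sub]
  exact norm_field_le m Λ (α - β) x

/-- Multiplication by a real function is symmetric. The real factor s accommodates the scaled
argument in the a priori bound; the actual equation has s = 1. -/
theorem inner_field_mul_comm (α : L2) {f₁ f₂ g₁ g₂ : L2} (s : ℝ)
    (h₁ : g₁ =ᵐ[volume] fun x => field m Λ α x * (s * f₁ x))
    (h₂ : g₂ =ᵐ[volume] fun x => field m Λ α x * (s * f₂ x)) :
    inner ℂ g₁ f₂ = inner ℂ f₁ g₂ := by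
  choose r hr using field_eq_ofReal m Λ α
  refine inner_mulReal_comm (a := fun x => r x * s) ?_ ?_
  · filter_upwards [h₁] with x hx
    rw [hx, hr]
    push_cast
    ring
  · filter_upwards [h₂] with x hx
    rw [hx, hr]
    push_cast
    ring

/-- The roles are exchanged here: 𝓕[ρ] is the bounded multiplier, because ρ is integrable, and η is
the L² function. -/
theorem memLp_source {N : ℕ} (φ : Fin N → L2) :
    MemLp (fun k => fourierT (density φ) k * etaL2 m Λ k) 2 volume :=
  memLp_mul_of_bound (continuous_fourierT (integrable_density φ)).aestronglyMeasurable
    (norm_fourierT_le _) _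

theorem norm_source_le {N : ℕ} (φ : Fin N → L2) :
    ‖mulL2 (fourierT (density φ)) (etaL2 m Λ)‖ ≤
      (2 * Real.pi) ^ (-3 / 2 : ℝ) * (∑ j, ‖φ j‖ ^ 2) * ‖etaL2 m Λ‖ := by
  rw [← integral_abs_density]
  exact norm_mulL2_le (continuous_fourierT (integrable_density φ)).aestronglyMeasurable
    (norm_fourierT_le _) _

theorem norm_source_sub_le {N : ℕ} (φ ψ : Fin N → L2) :
    ‖mulL2 (fourierT (density φ)) (etaL2 m Λ) - mulL2 (fourierT (density ψ)) (etaL2 m Λ)‖ ≤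
      (2 * Real.pi) ^ (-3 / 2 : ℝ) * (∑ j, ‖φ j - ψ j‖ * (‖φ j‖ + ‖ψ j‖)) * ‖etaL2 m Λ‖ := by
  refine mulL2_sub_left (continuous_fourierT (integrable_density φ)).aestronglyMeasurable
    (continuous_fourierT (integrable_density ψ)).aestronglyMeasurable
    (norm_fourierT_le _) (norm_fourierT_le _) (fun k => ?_) _
  rw [fourierT_sub (integrable_density φ) (integrable_density ψ)]
  refine (norm_fourierT_le _ k).trans ?_
  have hp := Real.pi_pos
  gcongr
  exact integral_abs_density_sub_le φ ψ

end Potential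

/-- The coupling constant `N^{-1} (2π)^{3/2}` of the source term. -/
noncomputable def coupling (N : ℕ) : ℝ := (N : ℝ)⁻¹ * (2 * Real.pi) ^ (3 / 2 : ℝ)

theorem coupling_nonneg (N : ℕ) : 0 ≤ coupling N := by
  have := Real.pi_pos
  unfold coupling
  positivity

/-- The nonlinear part of the system. -/
noncomputable def nonlinearity (N : ℕ) (m Λ : ℝ) (u : State N) : State N :=
  (fun j => (-(Complex.I * ((semiclassical N)⁻¹ : ℝ))) • mulL2 (field m Λ u.2) (u.1 j),
    (-(Complex.I * (coupling N : ℝ))) • mulL2 (fourierT (density u.1)) (etaL2 m Λ))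

theorem nonlinearity_fst (N : ℕ) (m Λ : ℝ) (u : State N) (j : Fin N) :
    (nonlinearity N m Λ u).1 j =
      (-(Complex.I * ((semiclassical N)⁻¹ : ℝ))) • mulL2 (field m Λ u.2) (u.1 j) := rfl

theorem nonlinearity_snd (N : ℕ) (m Λ : ℝ) (u : State N) :
    (nonlinearity N m Λ u).2 =
      (-(Complex.I * (coupling N : ℝ))) • mulL2 (fourierT (density u.1)) (etaL2 m Λ) := rfl

theorem norm_neg_I_mul_ofReal {r : ℝ} (hr : 0 ≤ r) : ‖-(Complex.I * (r : ℂ))‖ = r := by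
  rw [norm_neg, norm_mul, Complex.norm_I, one_mul, Complex.norm_real, Real.norm_of_nonneg hr]

theorem norm_fst_apply_le {N : ℕ} (u : State N) (j : Fin N) : ‖u.1 j‖ ≤ ‖u‖ :=
  (norm_le_pi_norm u.1 j).trans (norm_fst_le u)

theorem lipschitzOnWith_nonlinearity {N : ℕ} (hN : 1 ≤ N) (m Λ R : ℝ) :
    ∃ K : ℝ≥0, LipschitzOnWith K (nonlinearity N m Λ) (closedBall 0 R) := by
  rcases lt_or_ge R 0 with hR | hR
  · exact ⟨0, by simp [closedBall_eq_empty.2 hR]⟩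
  have hκ := inv_nonneg.2 (semiclassical_pos hN).le
  have hp : 0 ≤ (2 * Real.pi) ^ (-3 / 2 : ℝ) := by have := Real.pi_pos; positivity
  have hc := coupling_nonneg N
  set e := ‖etaL2 m Λ‖
  have he : 0 ≤ e := norm_nonneg _
  -- `K₁` collects two terms 2eR from the product of field and wave function; `K₂` collects N
  -- summands with ‖φ_j‖ + ‖ψ_j‖ ≤ 2R.
  set K₁ : ℝ := (semiclassical N)⁻¹ * (4 * e * R)
  set K₂ : ℝ := coupling N * ((2 * Real.pi) ^ (-3 / 2 : ℝ) * (N * (2 * R)) * e)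
  have hK₁ : 0 ≤ K₁ := by positivity
  have hK₂ : 0 ≤ K₂ := by positivity
  refine ⟨⟨K₁ + K₂, add_nonneg hK₁ hK₂⟩, LipschitzOnWith.of_dist_le_mul fun u hu v hv => ?_⟩
  rw [mem_closedBall_zero_iff] at hu hv
  rw [dist_eq_norm, dist_eq_norm]
  change _ ≤ (K₁ + K₂) * _
  have hd : 0 ≤ ‖u - v‖ := norm_nonneg _
  have hj : ∀ j, ‖u.1 j - v.1 j‖ ≤ ‖u - v‖ := fun j => norm_fst_apply_le (u - v) j
  have ha : ‖u.2 - v.2‖ ≤ ‖u - v‖ := norm_snd_le (u - v)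
  have huj : ∀ j, ‖u.1 j‖ ≤ R := fun j => (norm_fst_apply_le u j).trans hu
  have hvj : ∀ j, ‖v.1 j‖ ≤ R := fun j => (norm_fst_apply_le v j).trans hv
  have hu2 : ‖u.2‖ ≤ R := (norm_snd_le u).trans hu
  rw [Prod.norm_def]
  refine max_le ?_ ?_
  · refine (pi_norm_le_iff_of_nonneg (by positivity)).2 fun j => ?_
    rw [Prod.fst_sub, Pi.sub_apply, nonlinearity_fst, nonlinearity_fst, ← smul_sub, norm_smul, norm_neg_I_mul_ofReal hκ]
    calc _ ≤ (semiclassical N)⁻¹ * (2 * e * ‖u.2‖ * ‖u.1 j - v.1 j‖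
            + 2 * e * ‖u.2 - v.2‖ * ‖v.1 j‖) := by
          gcongr
          exact norm_field_mul_sub_le m Λ _ _ _ _
      _ ≤ (semiclassical N)⁻¹ * (2 * e * R * ‖u - v‖ + 2 * e * ‖u - v‖ * R) := by
          gcongr
          · exact hj j
          · exact hvj j
      _ = K₁ * ‖u - v‖ := by ring
      _ ≤ _ := by gcongr; linarith
  · rw [Prod.snd_sub, nonlinearity_snd, nonlinearity_snd, ← smul_sub, norm_smul, norm_neg_I_mul_ofReal hc]
    calc _ ≤ coupling N * ((2 * Real.pi) ^ (-3 / 2 : ℝ) *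
            (∑ j, ‖u.1 j - v.1 j‖ * (‖u.1 j‖ + ‖v.1 j‖)) * e) := by
          gcongr
          exact norm_source_sub_le m Λ _ _
      _ ≤ coupling N * ((2 * Real.pi) ^ (-3 / 2 : ℝ) *
            (∑ _j : Fin N, ‖u - v‖ * (R + R)) * e) := by
          gcongr with j
          · exact hj j
          · exact huj j
          · exact hvj j
      _ = K₂ * ‖u - v‖ := by
          simp only [Finset.sum_const, Finset.card_univ, Fintype.card_fin, nsmul_eq_mul, K₂]
          ring
      _ ≤ _ := by gcongr; linarith

/-! ### The free group on the state space and its domain -/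

/-- The symbol of the free field evolution. -/
noncomputable def fieldSymbol (N : ℕ) (m δ : ℝ) (k : R3) : ℝ := semiclassical N * δ * omega m k

theorem measurable_fieldSymbol (N : ℕ) (m δ : ℝ) : Measurable (fieldSymbol N m δ) :=
  (measurable_omega m).const_mul _

/-- The free evolution of the particles and of the field. -/
noncomputable def freeGroup (N : ℕ) (m δ : ℝ) : IsometryGroup (State N) where
  op t :=
    { toFun := fun u => (fun j => freeEvolution (semiclassical N) t (u.1 j),
        phase (measurable_fieldSymbol N m δ) t u.2)
      map_add' := fun u v => by
        refine Prod.ext (funext fun j => ?_) ?_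
        · exact map_add _ _ _
        · exact map_add _ _ _
      map_smul' := fun c u => by
        refine Prod.ext (funext fun j => ?_) ?_
        · exact ((freeEvolution (semiclassical N) t).restrictScalars ℝ).map_smul c (u.1 j)
        · exact ((phase (measurable_fieldSymbol N m δ) t).restrictScalars ℝ).map_smul c u.2
      norm_map' := fun u => by
        simp [Prod.norm_def, Pi.norm_def] }
  op_zero u := Prod.ext (funext fun j => freeEvolution_zero _ _) (phase_zero _ _)
  op_add s t u := Prod.ext (funext fun j => freeEvolution_add _ _ _ _) (phase_add _ _ _ _)
  tendsto_zero u := by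
    refine Tendsto.prodMk_nhds (tendsto_pi_nhds.2 fun j => ?_) ?_
    · exact tendsto_freeEvolution_zero _ _
    · exact tendsto_phase_zero _ _

theorem freeGroup_fst (N : ℕ) (m δ t : ℝ) (u : State N) (j : Fin N) :
    ((freeGroup N m δ).op t u).1 j = freeEvolution (semiclassical N) t (u.1 j) := rfl

theorem freeGroup_snd (N : ℕ) (m δ t : ℝ) (u : State N) :
    ((freeGroup N m δ).op t u).2 = phase (measurable_fieldSymbol N m δ) t u.2 := rfl

section Domain

theorem IsometryGroup.hasDerivAt_of_zero {X : Type*} [NormedAddCommGroup X] [NormedSpace ℝ X]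
    (U : IsometryGroup X) {x x' : X} {t : ℝ}
    (h : HasDerivAt (fun r => U.op r (U.op t x)) x' 0) :
    HasDerivAt (fun r => U.op r x) x' t := by
  have h1 : HasDerivAt (fun r => U.op r (U.op t x)) x' (t - t) := by rwa [sub_self]
  have h2 := h1.comp_sub_const t t
  refine h2.congr_of_eventuallyEq (Eventually.of_forall fun r => ?_)
  simp only [← U.op_add, sub_add_cancel]

theorem IsometryGroup.isLipschitzVector_of_hasDerivAt {X : Type*} [NormedAddCommGroup X]
    [NormedSpace ℝ X] (U : IsometryGroup X) {x x' : X}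
    (h : HasDerivAt (fun r => U.op r x) x' 0) : U.IsLipschitzVector x := by
  obtain ⟨C, hC⟩ := h.isBigO_sub.bound
  obtain ⟨ε, hε, hball⟩ := Metric.eventually_nhds_iff.1 hC
  -- Differentiability gives the bound |C| r for r < ε; for r ≥ ε the trivial bound 2‖x‖ is at most
  -- (2‖x‖/ε) r.
  refine ⟨|C| + 2 * ‖x‖ / ε, fun r hr => ?_⟩
  have hr0 : 0 < r := hr.1
  rw [add_mul]
  rcases lt_or_ge r ε with hlt | hge
  · have h1 := hball (y := r) (by rwa [Real.dist_eq, sub_zero, abs_of_pos hr0])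
    rw [U.op_zero, sub_zero, Real.norm_of_nonneg hr0.le] at h1
    have h2 : C * r ≤ |C| * r := by gcongr; exact le_abs_self C
    have h3 : 0 ≤ 2 * ‖x‖ / ε * r := by positivity
    linarith
  · have h1 := norm_sub_le (U.op r x) x
    rw [LinearIsometry.norm_map] at h1
    have h2 : 2 * ‖x‖ ≤ 2 * ‖x‖ / ε * r := by
      rw [div_mul_eq_mul_div, le_div_iff₀ hε]
      gcongr
    have h3 : 0 ≤ |C| * r := by positivity
    linarith

/-- The weights ω and (1 + |k|²)^{1/2} are comparable up to adding 1, since ω ≤ (1 + m)(1 +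
|k|²)^{1/2} ≤ (1 + m)(ω + 1). The added 1 is harmless for α in L² and is what covers m = 0. -/
theorem memL21_iff {c m : ℝ} (hc : 0 < c) (hm : 0 ≤ m) (α : L2) :
    MemL21 α ↔ MemLp (fun k => ((c * omega m k : ℝ) : ℂ) * α k) 2 volume := by
  have hs : ∀ k : R3, (1 + ‖k‖ ^ 2 : ℝ) ^ (1 / 2 : ℝ) = √(1 + ‖k‖ ^ 2) := fun k =>
    (Real.sqrt_eq_rpow _).symm
  unfold MemL21
  simp_rw [hs]
  have hms : AEStronglyMeasurable (fun k => ((√(1 + ‖k‖ ^ 2) : ℝ) : ℂ) * α k) volume := by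
    refine Measurable.aestronglyMeasurable (by fun_prop) |>.mul (Lp.aestronglyMeasurable α)
  have hmo : AEStronglyMeasurable (fun k => ((c * omega m k : ℝ) : ℂ) * α k) volume :=
    (Complex.measurable_ofReal.comp ((measurable_omega m).const_mul c)).aestronglyMeasurable.mul
      (Lp.aestronglyMeasurable α)
  constructor
  · intro h
    refine h.of_le_mul (c := c * (1 + m)) hmo (ae_of_all _ fun k => ?_)
    have ho := omega_nonneg m k
    have h1 : omega m k ≤ (1 + m) * √(1 + ‖k‖ ^ 2) := by
      refine Real.sqrt_le_iff.2 ⟨by positivity, ?_⟩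
      rw [mul_pow, Real.sq_sqrt (by positivity)]
      nlinarith [sq_nonneg ‖k‖, mul_nonneg hm (sq_nonneg ‖k‖),
        mul_nonneg (sq_nonneg m) (sq_nonneg ‖k‖)]
    rw [norm_mul, norm_mul, Complex.norm_real, Complex.norm_real,
      Real.norm_of_nonneg (Real.sqrt_nonneg _), Real.norm_of_nonneg (by positivity)]
    calc c * omega m k * ‖α k‖ ≤ c * ((1 + m) * √(1 + ‖k‖ ^ 2)) * ‖α k‖ := by gcongr
      _ = _ := by ring
  · intro h
    have h2 := (h.norm.const_mul c⁻¹).add (Lp.memLp α).norm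
    refine h2.of_le hms (ae_of_all _ fun k => ?_)
    have ho := omega_nonneg m k
    rw [Pi.add_apply, norm_mul, Complex.norm_real, Real.norm_of_nonneg (Real.sqrt_nonneg _),
      norm_mul, Complex.norm_real, Real.norm_of_nonneg (by positivity),
      Real.norm_of_nonneg (by positivity), ← mul_assoc, inv_mul_cancel_left₀ hc.ne']
    have h3 : √(1 + ‖k‖ ^ 2) ≤ omega m k + 1 := by
      refine Real.sqrt_le_iff.2 ⟨by positivity, ?_⟩
      have : omega m k ^ 2 = ‖k‖ ^ 2 + m ^ 2 := Real.sq_sqrt (by positivity)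
      nlinarith [sq_nonneg m]
    calc _ ≤ (omega m k + 1) * ‖α k‖ := by gcongr
      _ = _ := by ring

variable {N : ℕ} {m δ : ℝ}

theorem hasDerivAt_freeGroup_of_inDomain (hN : 1 ≤ N) (hm : 0 ≤ m) (hδ : 0 < δ) {u : State N}
    (hu : InDomain u) :
    ∃ g : Fin N → L2, (∀ j, IsLaplacian (u.1 j) (g j)) ∧
      MemLp (fun k => (fieldSymbol N m δ k : ℂ) * u.2 k) 2 volume ∧
      HasDerivAt (fun r => (freeGroup N m δ).op r u)
        (fun j => (Complex.I * (semiclassical N : ℂ)) • g j,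
          -(Complex.I • mulL2 (fun k => (fieldSymbol N m δ k : ℂ)) u.2)) 0 := by
  have hs := semiclassical_pos hN
  have h1 := fun j => exists_isLaplacian_hasDerivAt_freeEvolution hs.ne' (hu.1 j)
  choose g hg hgd using h1
  have h2 := (memL21_iff (mul_pos hs hδ) hm u.2).1 hu.2
  refine ⟨g, hg, h2, HasDerivAt.prodMk (hasDerivAt_pi.2 hgd) ?_⟩
  exact hasDerivAt_phase_zero (measurable_fieldSymbol N m δ) h2

/-- The converse direction: orbits of domain vectors are differentiable at zero, hence Lipschitz
there, so the domain is exactly the set of Lipschitz vectors. -/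
theorem inDomain_of_isLipschitzVector (hN : 1 ≤ N) (hm : 0 ≤ m) (hδ : 0 < δ) {u : State N}
    (hu : (freeGroup N m δ).IsLipschitzVector u) : InDomain u := by
  have hs := semiclassical_pos hN
  obtain ⟨C, hC⟩ := hu
  refine ⟨fun j => memH2_of_norm_freeEvolution_sub_le hs.ne' (C := C) fun h hh => ?_, ?_⟩
  · exact (norm_fst_apply_le ((freeGroup N m δ).op h u - u) j).trans (hC h hh)
  · refine (memL21_iff (mul_pos hs hδ) hm u.2).2 ?_
    refine memLp_mul_of_norm_phase_sub_le (measurable_fieldSymbol N m δ) (C := C) fun h hh => ?_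
    exact (norm_snd_le ((freeGroup N m δ).op h u - u)).trans (hC h hh)

end Domain

/-! ### The a priori bound -/

theorem hasDerivWithinAt_fst_apply {N : ℕ} {u : ℝ → State N} {v : State N} {s : Set ℝ} {t : ℝ}
    (h : HasDerivWithinAt u v s t) (j : Fin N) :
    HasDerivWithinAt (fun r => (u r).1 j) (v.1 j) s t :=
  ((ContinuousLinearMap.proj (R := ℝ) (φ := fun _ : Fin N => L2) j).comp
    (ContinuousLinearMap.fst ℝ (Fin N → L2) L2)).hasFDerivAt.comp_hasDerivWithinAt t h

theorem hasDerivWithinAt_snd {N : ℕ} {u : ℝ → State N} {v : State N} {s : Set ℝ} {t : ℝ}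
    (h : HasDerivWithinAt u v s t) : HasDerivWithinAt (fun r => (u r).2) v.2 s t :=
  (ContinuousLinearMap.snd ℝ (Fin N → L2) L2).hasFDerivAt.comp_hasDerivWithinAt t h

/-- In the interaction picture the norms of the particle wave functions are conserved and the norm
of the field grows at most linearly, also when the argument of the nonlinearity is scaled. -/
theorem norm_le_of_scaled_interaction {N : ℕ} (m Λ δ : ℝ) {T : ℝ} (hT : 0 ≤ T)
    {w : ℝ → State N} {s : ℝ → ℝ} (hs : ∀ t, s t ∈ Icc (0 : ℝ) 1)
    (hw : ∀ t ∈ Icc 0 T, HasDerivWithinAt w ((freeGroup N m δ).op (-t)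
      (nonlinearity N m Λ (s t • (freeGroup N m δ).op t (w t)))) (Icc 0 T) t) :
    ∀ t ∈ Icc 0 T, ‖w t‖ ≤ ‖w 0‖ + coupling N * ((2 * Real.pi) ^ (-3 / 2 : ℝ) *
      (∑ j, ‖(w 0).1 j‖ ^ 2) * ‖etaL2 m Λ‖) * T := by
  set G := freeGroup N m δ
  have hp : 0 ≤ (2 * Real.pi) ^ (-3 / 2 : ℝ) := by have := Real.pi_pos; positivity
  have hc := coupling_nonneg N
  have hpart : ∀ j, ∀ t ∈ Icc 0 T, ‖(w t).1 j‖ = ‖(w 0).1 j‖ := by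
    intro j
    have hder : ∀ t ∈ Icc 0 T,
        HasDerivWithinAt (fun r => inner ℂ ((w r).1 j) ((w r).1 j)) 0 (Icc 0 T) t := by
      intro t ht
      have h1 := hasDerivWithinAt_fst_apply (hw t ht) j
      have h1' := h1.inner ℂ h1
      set y := nonlinearity N m Λ (s t • G.op t (w t))
      set φ : L2 := (G.op t (w t)).1 j
      -- Applying the isometry to both entries of the scalar products removes the outer U(-t) and
      -- leaves the nonlinearity paired with φ.
      have hiso : ∀ f g : L2, inner ℂ (freeEvolution (semiclassical N) t f)
          (freeEvolution (semiclassical N) t g) = inner ℂ f g := fun f g =>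
        LinearIsometry.inner_map_map _ f g
      have e1 : freeEvolution (semiclassical N) t ((G.op (-t) y).1 j) = y.1 j := by
        rw [← freeGroup_fst N m δ, G.op_op_neg]
      rw [← hiso ((w t).1 j) ((G.op (-t) y).1 j), ← hiso ((G.op (-t) y).1 j) ((w t).1 j), e1,
        ← freeGroup_fst N m δ] at h1'
      set α : L2 := (s t • G.op t (w t)).2
      have hM : mulL2 (field m Λ α) ((s t • G.op t (w t)).1 j) =ᵐ[volume]
          fun x => field m Λ α x * (s t * φ x) := by
        have e2 : (s t • G.op t (w t)).1 j = s t • φ := rfl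
        rw [e2]
        filter_upwards [coeFn_mulL2 (memLp_field_mul m Λ α (s t • φ)), Lp.coeFn_smul (s t) φ]
          with x h2 h3
        rw [h2, h3, Pi.smul_apply, Complex.real_smul]
      have hsymm := inner_field_mul_comm m Λ α (s t) hM hM
      -- The potential acts symmetrically and is multiplied by an imaginary constant, so the two
      -- terms cancel.
      have h0 : inner ℂ φ (y.1 j) + inner ℂ (y.1 j) φ = 0 := by
        simp only [y]
        rw [nonlinearity_fst, inner_smul_left, inner_smul_right, hsymm, map_neg, map_mul,
          Complex.conj_I, Complex.conj_ofReal]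
        ring
      rwa [h0] at h1'
    have hconst := constant_of_has_deriv_right_zero
      (fun t ht => (hder t ht).continuousWithinAt)
      (fun t ht => hasDerivWithinAt_Ici_of_Icc ht (hder t (Ico_subset_Icc_self ht)))
    intro t ht
    have h1 := hconst t ht
    rw [inner_self_eq_norm_sq_to_K, inner_self_eq_norm_sq_to_K] at h1
    have h2 : ‖(w t).1 j‖ ^ 2 = ‖(w 0).1 j‖ ^ 2 := by exact_mod_cast h1
    exact (sq_eq_sq₀ (norm_nonneg _) (norm_nonneg _)).1 h2
  set M := coupling N * ((2 * Real.pi) ^ (-3 / 2 : ℝ) * (∑ j, ‖(w 0).1 j‖ ^ 2) * ‖etaL2 m Λ‖)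
  have hM : 0 ≤ M := by positivity
  intro t ht
  -- The source depends only on the particles, whose norms are conserved, and scaling by `s r` ≤ 1
  -- can only decrease its bound; so the field moves with speed at most M.
  have hfield : ‖(w t).2 - (w 0).2‖ ≤ M * (t - 0) := by
    refine norm_image_sub_le_of_norm_deriv_le_segment' (f := fun r => (w r).2)
      (fun r hr => hasDerivWithinAt_snd (hw r hr)) (fun r hr => ?_) t ht
    rw [freeGroup_snd, LinearIsometry.norm_map, nonlinearity_snd, norm_smul,
      norm_neg_I_mul_ofReal hc]
    simp only [M]
    gcongr
    refine (norm_source_le m Λ _).trans ?_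
    gcongr with j
    change ‖s r • freeEvolution (semiclassical N) r ((w r).1 j)‖ ≤ _
    rw [norm_smul, LinearIsometry.norm_map, hpart j r (Ico_subset_Icc_self hr),
      Real.norm_of_nonneg (hs r).1]
    exact mul_le_of_le_one_left (norm_nonneg _) (hs r).2
  have hMT : M * (t - 0) ≤ M * T := by rw [sub_zero]; gcongr; exact ht.2
  have hMT0 : 0 ≤ M * T := by positivity
  rw [Prod.norm_def]
  refine max_le ((pi_norm_le_iff_of_nonneg (by positivity)).2 fun j => ?_) ?_
  · rw [hpart j t ht]
    linarith [norm_fst_apply_le (w 0) j]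
  · have h1 : ‖(w t).2‖ ≤ ‖(w 0).2‖ + ‖(w t).2 - (w 0).2‖ := by
      simpa using norm_add_le (w 0).2 ((w t).2 - (w 0).2)
    linarith [norm_snd_le (w 0)]

/-! ### Existence of strong solutions and conservation of orthonormality -/

section Solutions

variable {N : ℕ} {m δ : ℝ}

/-- The generator of the free evolution plus the nonlinearity gives the right-hand sides of the
system. -/
theorem equations_of_derivative (hN : 1 ≤ N) (Λ : ℝ) {u : State N} {g : Fin N → L2}
    (hg : ∀ j, IsLaplacian (u.1 j) (g j))
    (hα : MemLp (fun k => (fieldSymbol N m δ k : ℂ) * u.2 k) 2 volume) :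
    let v : State N := (fun j => (Complex.I * (semiclassical N : ℂ)) • g j,
      -(Complex.I • mulL2 (fun k => (fieldSymbol N m δ k : ℂ)) u.2)) + nonlinearity N m Λ u
    (∀ j, SchroedingerEq N (field m Λ u.2) (u.1 j) (v.1 j)) ∧
      KleinGordonEq N m Λ δ (density u.1) u.2 v.2 := by
  intro v
  have hs : (semiclassical N : ℂ) ≠ 0 := Complex.ofReal_ne_zero.2 (semiclassical_pos hN).ne'
  refine ⟨fun j => ⟨g j, hg j, ?_⟩, ?_⟩
  · rw [← semiclassical_mul_self hN]
    change ∀ᵐ x, (semiclassical N : ℂ) * Complex.I *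
      ((Complex.I * (semiclassical N : ℂ)) • g j + (nonlinearity N m Λ u).1 j : L2) x = _
    rw [nonlinearity_fst]
    filter_upwards [Lp.coeFn_add ((Complex.I * (semiclassical N : ℂ)) • g j)
      ((-(Complex.I * ((semiclassical N)⁻¹ : ℝ))) • mulL2 (field m Λ u.2) (u.1 j)),
      Lp.coeFn_smul (Complex.I * (semiclassical N : ℂ)) (g j),
      Lp.coeFn_smul (-(Complex.I * ((semiclassical N)⁻¹ : ℝ))) (mulL2 (field m Λ u.2) (u.1 j)),
      coeFn_mulL2 (memLp_field_mul m Λ u.2 (u.1 j))] with x h1 h2 h3 h4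
    rw [h1, Pi.add_apply, h2, h3, Pi.smul_apply, Pi.smul_apply, h4, smul_eq_mul, smul_eq_mul]
    push_cast
    field_simp
    linear_combination ((semiclassical N : ℂ) ^ 2 * g j x - field m Λ u.2 x * u.1 j x) *
      Complex.I_sq
  · change ∀ᵐ k, Complex.I * (-(Complex.I • mulL2 (fun k => (fieldSymbol N m δ k : ℂ)) u.2) +
      (nonlinearity N m Λ u).2 : L2) k = _
    rw [nonlinearity_snd]
    set A := mulL2 (fun k => (fieldSymbol N m δ k : ℂ)) u.2
    set B := mulL2 (fourierT (density u.1)) (etaL2 m Λ)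
    filter_upwards [Lp.coeFn_add (-(Complex.I • A)) ((-(Complex.I * (coupling N : ℝ))) • B),
      Lp.coeFn_neg (Complex.I • A), Lp.coeFn_smul Complex.I A,
      Lp.coeFn_smul (-(Complex.I * (coupling N : ℝ))) B, coeFn_mulL2 hα,
      coeFn_mulL2 (memLp_source m Λ u.1), coeFn_etaL2 m Λ] with k h1 h2 h3 h4 h5 h6 h7
    rw [h1, Pi.add_apply, h2, Pi.neg_apply, h3, h4, Pi.smul_apply, Pi.smul_apply, h5, h6, h7,
      smul_eq_mul, smul_eq_mul]
    simp only [fieldSymbol, coupling, semiclassical]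
    push_cast
    linear_combination (-((((N : ℝ) ^ (-1 / 3 : ℝ) : ℝ) : ℂ) * δ * omega m k * u.2 k +
      (N : ℂ)⁻¹ * (((2 * Real.pi) ^ (3 / 2 : ℝ) : ℝ) : ℂ) * fourierT (density u.1) k *
        eta m Λ k)) * Complex.I_sq

theorem exists_isSolution (hN : 1 ≤ N) (Λ : ℝ) (hm : 0 ≤ m) (hδ : 0 < δ) {u₀ : State N}
    (hu₀ : InDomain u₀) : ∃ u : ℝ → State N, u 0 = u₀ ∧ IsSolution N m Λ δ u := by
  set G := freeGroup N m δ
  have hF := lipschitzOnWith_nonlinearity hN m Λ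
  obtain ⟨w, hw0, hw⟩ := exists_global_solution (V := G.interaction (nonlinearity N m Λ))
    (x₀ := u₀)
    (fun R => (hF R).imp fun K hK t => G.lipschitzOnWith_interaction hK t)
    (fun T hT => G.exists_solution_Icc hF u₀ (B := ‖u₀‖ + coupling N *
      ((2 * Real.pi) ^ (-3 / 2 : ℝ) * (∑ j, ‖u₀.1 j‖ ^ 2) * ‖etaL2 m Λ‖) * T) hT fun w s hs hw0 hw => by
      subst hw0
      exact norm_le_of_scaled_interaction m Λ δ hT hs hw)
  obtain ⟨g₀, -, -, hg₀⟩ := hasDerivAt_freeGroup_of_inDomain hN hm hδ hu₀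
  have hlip : G.IsLipschitzVector (w 0) := by
    rw [hw0]
    exact G.isLipschitzVector_of_hasDerivAt hg₀
  refine ⟨fun t => G.op t (w t), by simp only [G.op_zero, hw0], fun t ht => ?_⟩
  have hdom : InDomain (G.op t (w t)) := inDomain_of_isLipschitzVector hN hm hδ
    (G.isLipschitzVector_of_solution hF hw hlip ht)
  obtain ⟨g, hg, hα, hd⟩ := hasDerivAt_freeGroup_of_inDomain hN hm hδ hdom
  -- Undoing the interaction picture: the product rule gives the generator at u(t) plus U(t) U(-t)
  -- F(u(t)) = F(u(t)).
  have hder := G.hasDerivWithinAt_op_apply (hw t ht) (G.hasDerivAt_of_zero hd)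
  rw [IsometryGroup.interaction, G.op_op_neg] at hder
  exact ⟨hdom, _, hder, equations_of_derivative hN Λ hg hα⟩

/-- The Schrödinger equation conserves scalar products. -/
theorem inner_add_inner_eq_zero (hN : 1 ≤ N) (Λ : ℝ) {α φ₁ φ₂ v₁ v₂ : L2}
    (h₁ : SchroedingerEq N (field m Λ α) φ₁ v₁) (h₂ : SchroedingerEq N (field m Λ α) φ₂ v₂) :
    inner ℂ φ₁ v₂ + inner ℂ v₁ φ₂ = 0 := by
  have hs : (semiclassical N : ℂ) ≠ 0 := Complex.ofReal_ne_zero.2 (semiclassical_pos hN).ne'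
  -- The equation is turned into an identity in L², which can be paired with another wave function.
  have key : ∀ {φ v g : L2}, (∀ᵐ x : R3, (((N : ℝ) ^ (-1 / 3 : ℝ) : ℝ) : ℂ) * Complex.I * v x =
      -(((N : ℝ) ^ (-2 / 3 : ℝ) : ℝ) : ℂ) * g x + field m Λ α x * φ x) →
      ((semiclassical N : ℂ) * Complex.I) • v =
        (-(((N : ℝ) ^ (-2 / 3 : ℝ) : ℝ) : ℂ)) • g + mulL2 (field m Λ α) φ := by
    intro φ v g h
    refine Lp.ext ?_
    filter_upwards [h, Lp.coeFn_smul ((semiclassical N : ℂ) * Complex.I) v,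
      Lp.coeFn_add ((-(((N : ℝ) ^ (-2 / 3 : ℝ) : ℝ) : ℂ)) • g) (mulL2 (field m Λ α) φ),
      Lp.coeFn_smul (-(((N : ℝ) ^ (-2 / 3 : ℝ) : ℝ) : ℂ)) g,
      coeFn_mulL2 (memLp_field_mul m Λ α φ)] with x h1 h2 h3 h4 h5
    rw [h2, h3, Pi.add_apply, h4, h5, Pi.smul_apply, Pi.smul_apply]
    exact h1
  obtain ⟨g₁, hg₁, e₁⟩ := h₁
  obtain ⟨g₂, hg₂, e₂⟩ := h₂
  have hΔ := hg₁.inner_comm hg₂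
  have hM : ∀ φ : L2, mulL2 (field m Λ α) φ =ᵐ[volume]
      fun x => field m Λ α x * (((1 : ℝ) : ℂ) * φ x) := fun φ => by
    filter_upwards [coeFn_mulL2 (memLp_field_mul m Λ α φ)] with x hx
    rw [hx]
    push_cast
    ring
  have hΦ := inner_field_mul_comm m Λ α 1 (hM φ₁) (hM φ₂)
  have k₁ := congrArg (fun f : L2 => inner ℂ f φ₂) (key e₁)
  have k₂ := congrArg (fun f : L2 => inner ℂ φ₁ f) (key e₂)
  simp only [inner_add_left, inner_add_right, inner_smul_left, inner_smul_right, map_mul, map_neg,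
    Complex.conj_ofReal, Complex.conj_I] at k₁ k₂
  -- Pairing one equation with φ₁ and the other with φ₂ and subtracting cancels the Laplacian and
  -- potential terms by symmetry; the conjugation of i turns the difference of the time derivatives
  -- into a sum.
  have h : (semiclassical N : ℂ) * Complex.I * (inner ℂ φ₁ v₂ + inner ℂ v₁ φ₂) = 0 := by
    linear_combination k₂ - k₁ + (((N : ℝ) ^ (-2 / 3 : ℝ) : ℝ) : ℂ) * hΔ - hΦ
  exact (mul_eq_zero.1 h).resolve_left (mul_ne_zero hs Complex.I_ne_zero)

theorem orthonormal_of_isSolution (hN : 1 ≤ N) (Λ : ℝ) {u : ℝ → State N}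
    (hu : IsSolution N m Λ δ u)
    (h0 : Orthonormal ℂ (u 0).1) {t : ℝ} (ht : 0 ≤ t) : Orthonormal ℂ (u t).1 := by
  classical
  rw [orthonormal_iff_ite] at h0 ⊢
  intro i j
  rw [← h0 i j]
  have hder : ∀ r, 0 ≤ r →
      HasDerivWithinAt (fun r => inner ℂ ((u r).1 i) ((u r).1 j)) 0 (Ici 0) r := fun r hr => by
    obtain ⟨-, v, hv, hS, -⟩ := hu r hr
    have h := (hasDerivWithinAt_fst_apply hv i).inner ℂ (hasDerivWithinAt_fst_apply hv j)
    rwa [inner_add_inner_eq_zero hN Λ (hS i) (hS j)] at h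
  exact constant_of_has_deriv_right_zero
    (fun r hr => (hder r hr.1).continuousWithinAt.mono Icc_subset_Ici_self)
    (fun r hr => (hder r hr.1).mono (Ici_subset_Ici.2 hr.1)) t ⟨ht, le_rfl⟩

end Solutions

end

end FSKG

theorem proposition1p1 (N : ℕ) (hN : 1 ≤ N) (m Λ δ : ℝ) (hm : 0 ≤ m) (hΛ : 1 ≤ Λ) (hδ : 0 < δ)
    (u₀ : FSKG.State N) (hu₀ : FSKG.InDomain u₀) :
    (∃ u : ℝ → FSKG.State N, u 0 = u₀ ∧ FSKG.IsSolution N m Λ δ u) ∧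
    (∀ u : ℝ → FSKG.State N, u 0 = u₀ → FSKG.IsSolution N m Λ δ u →
      Orthonormal ℂ u₀.1 → ∀ t : ℝ, 0 ≤ t → Orthonormal ℂ (u t).1) :=
  ⟨FSKG.exists_isSolution hN Λ hm hδ hu₀, fun _ h0 hu ho _ ht =>
    FSKG.orthonormal_of_isSolution hN Λ hu (h0 ▸ ho) ht⟩
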